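/- Let $q=2^h$ with $h\ge 1$ odd, let $1\le s\le 5$ with $\gcd(s,6)=1$, put $\sigma: x\mapsto x^{q^s}$ on $\mathbb{F}_{q^6}$, and let $$U_s=\{(x,y,x^{\sigma^2}+y^{\sigma},x^{\sigma}+y^{\sigma^3}) : x,y\in\mathbb{F}_{q^6},\ \mathrm{Tr}_{q^6/q^2}(x)=\mathrm{Tr}_{q^6/q^2}(y)=0\}\subseteq \mathbb{F}_{q^6}^4 .$$ Definitions. For an $\mathbb{F}_q$-subspace $U$ of $\mathbb{F}_{q^m}^k$ of $\mathbb{F}_q$-dimension $n$ and $1\le\rho\le k$, the $\rho$-th generalized rank weight is $d_\rho(U)=n-\max\{\dim_{\mathbb{F}_q}(H\cap U): H\le\mathbb{F}_{q^m}^k,\ \dim_{\mathbb{F}_{q^m}}H=k-\rho\}$. $U$ is an $[n,k,d]_{q^m/q}$ system if moreover it spans $\mathbb{F}_{q^m}^k$ over $\mathbb{F}_{q^m}$ and $d_1(U)=d$. An $[n,k,d]_{q^m/q}$ code is a $k$-dimensional $\mathbb{F}_{q^m}$-subspace $\mathcal C$ of $\mathbb{F}_{q^m}^n$ whose minimum distance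 $d(\mathcal C)$, i.e. the least rank weight $\dim_{\mathbb{F}_q}\langle v_1,\dots,v_n\rangle_{\mathbb{F}_q}$ of a nonzero codeword $v$, equals $d$; it is MRD if $mk=\min\{m(n-d+1),n(m-d+1)\}$. It is associated with $U$ if the columns of some $k\times n$ generator matrix of $\mathcal C$ form an $\mathbb{F}_q$-basis of $U$, and then $d_\rho(\mathcal C):=d_\rho(U)$. The code is $\rho$-MRD if $d_\rho(\mathcal C)=n-k+\rho$, and near MRD if $d(\mathcal C)=n-k$ and $d_\rho(\mathcal C)=n-k+\rho$ for all $2\le\rho\le k$. Statement. $U_s$ is an $[8,4,4]_{q^6/q}$ system, so there are codes $\mathcal C\subseteq\mathbb{F}_{q^6}^8$ associated with it. Every such code $\mathcal C$ is an $[8,4,4]_{q^6/q}$ MRD code with second generalized rank weight $d_2(\mathcal C)=6$. Hence $\mathcal C$ is $2$-MRD but not $1$-MRD, and it is a near MRD code. -/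

import Mathlib

/-! Rank-metric codes, `q`-systems, generalized rank weights and the subspaces `U_s`.

Throughout, `F ⊆ K` is an extension of finite fields, `F = 𝔽_q`, `K = 𝔽_{q^m}`. -/

namespace RankMetric

section Codes

variable (F : Type*) {K : Type*} [Field F] [Field K] [Algebra F K]

/-- The rank weight of a vector: the `F`-dimension of the `F`-span of its coordinates. -/
noncomputable def rankWeight {n : ℕ} (v : Fin n → K) : ℕ :=
  Module.finrank F (Submodule.span F (Set.range v))

/-- `d` is the minimum distance of the linear code `C`: the least rank weight of a nonzero
codeword. -/
def IsMinDist {n : ℕ} (C : Submodule K (Fin n → K)) (d : ℕ) : Prop :=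
  IsLeast {w : ℕ | ∃ c ∈ C, c ≠ 0 ∧ rankWeight F c = w} d

/-- `C` is a linear rank-metric code with parameters `[n, k, d]`. -/
def IsCode {n : ℕ} (C : Submodule K (Fin n → K)) (k d : ℕ) : Prop :=
  Module.finrank K C = k ∧ IsMinDist F C d

/-- Maximum rank distance codes: equality holds in the Singleton-like bound
`m k ≤ min {m (n - d + 1), n (m - d + 1)}`, where `m = [K : F]`, `k = dim C`.
(The minimum distance satisfies `d ≤ n` and `d ≤ m`.) -/
def IsMRD {n : ℕ} (C : Submodule K (Fin n → K)) : Prop :=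
  ∃ d : ℕ, IsMinDist F C d ∧
    Module.finrank F K * Module.finrank K C =
      min (Module.finrank F K * (n - d + 1)) (n * (Module.finrank F K - d + 1))

variable {F}

/-- The weight of a `K`-subspace `H` in an `F`-subspace `U`: `dim_F (H ∩ U)`. -/
noncomputable def weight {k : ℕ} (U : Submodule F (Fin k → K)) (H : Submodule K (Fin k → K)) :
    ℕ :=
  Module.finrank F (H.restrictScalars F ⊓ U : Submodule F (Fin k → K))

/-- `d` is the `ρ`-th generalized rank weight of `U`:
`d = dim_F U - max {wt_U(H) : dim_K H = k - ρ}`. -/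
def IsSystemGenWeight {k : ℕ} (U : Submodule F (Fin k → K)) (ρ d : ℕ) : Prop :=
  ∃ w : ℕ, IsGreatest
      {x : ℕ | ∃ H : Submodule K (Fin k → K), Module.finrank K H + ρ = k ∧ weight U H = x} w ∧
    d + w = Module.finrank F U

/-- `U` is an `[n, k, d]` system. -/
def IsSystem {k : ℕ} (U : Submodule F (Fin k → K)) (n d : ℕ) : Prop :=
  Module.finrank F U = n ∧ Submodule.span K (U : Set (Fin k → K)) = ⊤ ∧ IsSystemGenWeight U 1 d

/-- The code `C` is associated with the `F`-subspace `U` of `K^k`: some generator matrix `G` of `C`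
(its rows form a `K`-basis of `C`) has columns that form an `F`-basis of `U`. -/
def IsAssociated {n k : ℕ} (C : Submodule K (Fin n → K)) (U : Submodule F (Fin k → K)) : Prop :=
  ∃ G : Matrix (Fin k) (Fin n) K,
    LinearIndependent K G.row ∧ Submodule.span K (Set.range G.row) = C ∧
    LinearIndependent F G.col ∧ Submodule.span F (Set.range G.col) = U

variable (F)

/-- `d` is the `ρ`-th generalized rank weight of the code `C`: the one of a system with which `C`
is associated. -/
def IsGenWeight {n : ℕ} (C : Submodule K (Fin n → K)) (ρ d : ℕ) : Prop :=
  ∃ (k : ℕ) (U : Submodule F (Fin k → K)), IsAssociated C U ∧ IsSystemGenWeight U ρ d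

/-- `C` is `ρ`-MRD: `d_ρ(C) = n - k + ρ`, where `k = dim C`. -/
def IsRhoMRD {n : ℕ} (C : Submodule K (Fin n → K)) (ρ : ℕ) : Prop :=
  IsGenWeight F C ρ (n - Module.finrank K C + ρ)

/-- `C` is near MRD: `d(C) = n - k` and `d_ρ(C) = n - k + ρ` for `2 ≤ ρ ≤ k`. -/
def IsNearMRD {n : ℕ} (C : Submodule K (Fin n → K)) : Prop :=
  IsMinDist F C (n - Module.finrank K C) ∧
    ∀ ρ : ℕ, 2 ≤ ρ → ρ ≤ Module.finrank K C →
      IsGenWeight F C ρ (n - Module.finrank K C + ρ)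

end Codes

section GenWeightUnique

variable {F K : Type*} [Field F] [Field K] [Algebra F K]

/-- The generalized weights of a system are unchanged under `K`-linear automorphisms. -/
theorem IsSystemGenWeight.map {k : ℕ} {U : Submodule F (Fin k → K)} {ρ d : ℕ}
    (h : IsSystemGenWeight U ρ d) (e : (Fin k → K) ≃ₗ[K] (Fin k → K)) :
    IsSystemGenWeight (U.map (e.restrictScalars F).toLinearMap) ρ d := by
  obtain ⟨w, hw, hd⟩ := h
  have key : ∀ (f : (Fin k → K) ≃ₗ[K] (Fin k → K)) (H : Submodule K (Fin k → K))
      (V : Submodule F (Fin k → K)),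
      weight (V.map (f.restrictScalars F).toLinearMap) (H.map f.toLinearMap) = weight V H := by
    intro f H V
    unfold weight
    have : ((H.map f.toLinearMap).restrictScalars F ⊓
        V.map (f.restrictScalars F).toLinearMap : Submodule F (Fin k → K)) =
        (H.restrictScalars F ⊓ V).map (f.restrictScalars F).toLinearMap := by
      ext x
      simp only [Submodule.mem_inf, Submodule.restrictScalars_mem, Submodule.mem_map]
      constructor
      · rintro ⟨⟨a, ha, rfl⟩, ⟨b, hb, hab⟩⟩
        have : b = a := f.injective hab
        exact ⟨a, ⟨ha, this ▸ hb⟩, rfl⟩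
      · rintro ⟨a, ⟨ha, hb⟩, rfl⟩
        exact ⟨⟨a, ha, rfl⟩, ⟨a, hb, rfl⟩⟩
    rw [this]
    exact LinearEquiv.finrank_map_eq (f.restrictScalars F) _
  refine ⟨w, ⟨?_, ?_⟩, ?_⟩
  · obtain ⟨H, hH, hwt⟩ := hw.1
    exact ⟨H.map e.toLinearMap, by rw [LinearEquiv.finrank_map_eq e H]; exact hH,
      by rw [key]; exact hwt⟩
  · rintro x ⟨H, hH, rfl⟩
    refine hw.2 ⟨H.map e.symm.toLinearMap, ?_, ?_⟩
    · rw [LinearEquiv.finrank_map_eq e.symm H]; exact hH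
    · rw [← key e]
      congr 1
      ext y
      simp
  · rw [hd]
    exact (LinearEquiv.finrank_map_eq (e.restrictScalars F) U).symm

theorem IsAssociated.finrank_eq {n k : ℕ} {C : Submodule K (Fin n → K)}
    {U : Submodule F (Fin k → K)} (h : IsAssociated C U) : Module.finrank K C = k := by
  obtain ⟨G, hG, hGC, -, -⟩ := h
  rw [← hGC, finrank_span_eq_card hG, Fintype.card_fin]

/-- Two systems with which the same code is associated differ by a `K`-linear automorphism. -/
theorem IsAssociated.exists_equiv {n k : ℕ} {C : Submodule K (Fin n → K)}
    {U U' : Submodule F (Fin k → K)} (h : IsAssociated C U) (h' : IsAssociated C U') :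
    ∃ e : (Fin k → K) ≃ₗ[K] (Fin k → K), U' = U.map (e.restrictScalars F).toLinearMap := by
  obtain ⟨G, hG, hGC, -, hGU⟩ := h
  obtain ⟨G', hG', hGC', -, hGU'⟩ := h'
  let b : Module.Basis (Fin k) K C := (Module.Basis.span hG).map (LinearEquiv.ofEq _ _ hGC)
  let b' : Module.Basis (Fin k) K C := (Module.Basis.span hG').map (LinearEquiv.ofEq _ _ hGC')
  have hb : ∀ i, ((b i : C) : Fin n → K) = G.row i := fun i => by
    simp [b, Module.Basis.span_apply]
  have hb' : ∀ i, ((b' i : C) : Fin n → K) = G'.row i := fun i => by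
    simp [b', Module.Basis.span_apply]
  let A : Matrix (Fin k) (Fin k) K := (b.toMatrix b').transpose
  let _ : Invertible (b.toMatrix b') := b.invertibleToMatrix b'
  have hA : Invertible A := Matrix.invertibleTranspose _
  have hcol : ∀ j, G'.col j = A.mulVec (G.col j) := by
    intro j
    ext i
    have h1 := b.sum_toMatrix_smul_self b' i
    have h2 := congrArg (fun c : C => (c : Fin n → K) j) h1
    simp only [Submodule.coe_sum, Submodule.coe_smul, hb, hb', Finset.sum_apply,
      Pi.smul_apply, smul_eq_mul] at h2
    exact h2.symm
  refine ⟨A.toLinearEquiv' hA, ?_⟩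
  rw [← hGU, ← hGU', Submodule.map_span, ← Set.range_comp]
  congr 2
  funext j
  exact hcol j

/-- The generalized rank weights of a code do not depend on the associated system, so `IsGenWeight`
determines `d`. -/
theorem IsAssociated.isGenWeight_iff {n k : ℕ} {C : Submodule K (Fin n → K)}
    {U : Submodule F (Fin k → K)} (h : IsAssociated C U) (ρ d : ℕ) :
    IsGenWeight F C ρ d ↔ IsSystemGenWeight U ρ d := by
  constructor
  · rintro ⟨k', U', h', hd⟩
    obtain rfl : k' = k := by rw [← h.finrank_eq, ← h'.finrank_eq]
    obtain ⟨e, rfl⟩ := h'.exists_equiv h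
    exact hd.map e
  · exact fun hd => ⟨k, U, h, hd⟩

end GenWeightUnique

section TheSubspace

variable (F E K : Type*) [Field F] [Fintype F] [Field E] [Field K]
  [Algebra F E] [Algebra F K] [Algebra E K] [IsScalarTower F E K]

/-- The map `σ : x ↦ x ^ (q ^ s)` of `K`, where `q = |F|`. -/
noncomputable def sigma (s : ℕ) : K →ₐ[F] K := FiniteField.frobeniusAlgHom F K ^ s

theorem sigma_apply (s : ℕ) (x : K) : sigma F K s x = x ^ (Fintype.card F ^ s) := by
  induction s with
  | zero => simp [sigma]
  | succ s ih =>
    have h : sigma F K (s + 1) x = sigma F K s (FiniteField.frobeniusAlgHom F K x) := by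
      simp [sigma, pow_succ]
    rw [h, FiniteField.frobeniusAlgHom_apply, map_pow, ih, ← pow_mul, ← pow_succ]

/-- `U_s = {(x, y, x^{σ²} + y^σ, x^σ + y^{σ³}) : x, y ∈ K, Tr_{K/E}(x) = Tr_{K/E}(y) = 0}`,
to be used with `F = 𝔽_q`, `E = 𝔽_{q²}`, `K = 𝔽_{q⁶}`. -/
noncomputable def systemU (s : ℕ) : Submodule F (Fin 4 → K) where
  carrier := {v | ∃ x y : K, Algebra.trace E K x = 0 ∧ Algebra.trace E K y = 0 ∧
    v = ![x, y, (sigma F K s)^[2] x + sigma F K s y, sigma F K s x + (sigma F K s)^[3] y]}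
  zero_mem' := ⟨0, 0, by simp, by simp, by ext i; fin_cases i <;> simp⟩
  add_mem' := by
    rintro _ _ ⟨x, y, hx, hy, rfl⟩ ⟨x', y', hx', hy', rfl⟩
    refine ⟨x + x', y + y', by simp [hx, hx'], by simp [hy, hy'], ?_⟩
    ext i
    fin_cases i <;> simp <;> ring
  smul_mem' := by
    rintro c _ ⟨x, y, hx, hy, rfl⟩
    have ht : ∀ z : K, Algebra.trace E K z = 0 → Algebra.trace E K (c • z) = 0 := by
      intro z hz
      rw [← algebraMap_smul E c z, map_smul, hz, smul_zero]
    refine ⟨c • x, c • y, ht x hx, ht y hy, ?_⟩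
    ext i
    fin_cases i <;> simp

end TheSubspace

end RankMetric

/-!
Write `E = 𝔽_{q²}` and let `e ↦ ē` be the restriction of `σ` to `E`, an involution. As `h` and `s`
are odd, `E` contains `ω` with `ω² = ω + 1` and `ω̄ = ω + 1`. A Lagrange resolvent `ε` with
`σ² ε = ω² ε` gives a basis `1, ε, ε²` of `K` over `E` such that `ker Tr = εE ⊕ ε²E` and
`σ ε = κ ε²` for some `κ ∈ E` (`exists_kummerFrame`).

The heart of the matter is that vectors `w_j` of `U_s` that are independent over `𝔽_q` satisfy no
nontrivial relation `∑ c_j w_j = 0` with all `c_j` in a three-dimensional `𝔽_q`-subspace `S` of `K`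
(`KummerFrame.coeff_eq_zero`). It suffices to show that `∑ t_j w_j = 0` with `w_j ∈ U_s` forces
`w = 0` for one generating triple `t` of `S`.

* If `S` has a basis `t` independent over `E`, there is a semilinear involution `Θ` of the
  three-dimensional `E`-space `K` that fixes each `t_j`. For `Ψ = κ̄ ε Θ` the relation amounts to
  two equations in vectors `p`, `r`, from which `Ψ⁴ r + ω² Ψ³ r + Ψ² r + ω² Ψ r + r = 0` follows.
  The reduced norm of this twisted polynomial is `Z⁴ + Z³ + Z² + Z + 1` in `Z = Ψ²`, and `E` has no
  primitive fifth root of unity because `q² ≡ 4` modulo `5`. A nonzero `r` would therefore generate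
  an `E[Ψ]`-module of dimension four, too large for `K` (`eq_zero_of_semilinear_relations`).
* Otherwise `S` contains a line `E t`, and comparing coefficients of `1, ε, ε²` leads to an element
  of `E` that is a root of the same polynomial (`KummerFrame.eq_zero_of_mul_mem_comb`).

Consequently up to three `𝔽_q`-independent vectors of `U_s` are independent over `K`, which gives
the generalized weights of order at least two. The first one comes from the duality of MRD codes in
the form of a dimension count (`RelationFree.lt_finrank_map`): as `8 · 3 = 4 · 6`, the values of a
nonzero linear form on `U_s` span at least four dimensions over `𝔽_q`. The form `x` attains this
bound. Codewords of an associated code correspond to linear forms, and their rank weight is the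
dimension of the space of values.
-/

namespace RankMetric

/-! ### Semilinear maps of a three-dimensional space -/

section Semilinear

variable {E V : Type*} [Field E] [AddCommGroup V] [Module E V]

/-- The square of a semilinear map whose twist is an involution, as a linear map. -/
def semilinearSq (τ : E →+* E) (hτ : ∀ x, τ (τ x) = x) (Ψ : V →ₛₗ[τ] V) : V →ₗ[E] V where
  toFun v := Ψ (Ψ v)
  map_add' := by simp
  map_smul' := by simp [hτ]

/-- The kernel of `Z² + θ Z + 1`. -/
def quadKer (Z : V →ₗ[E] V) (θ : E) : Submodule E V :=
  LinearMap.ker (Z ∘ₗ Z + θ • Z + LinearMap.id)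

theorem mem_quadKer {Z : V →ₗ[E] V} {θ : E} {v : V} :
    v ∈ quadKer Z θ ↔ Z (Z v) + θ • Z v + v = 0 := by
  simp [quadKer]

variable [CharP E 2]

/-- An eigenvalue of `Z` on the kernel of `Z² + θ Z + 1`, with `θ² = θ + 1`, would be a primitive
fifth root of unity. -/
theorem two_le_finrank_quadKer [FiniteDimensional E V]
    (h5 : ∀ m : E, m ^ 4 + m ^ 3 + m ^ 2 + m + 1 ≠ 0) {Z : V →ₗ[E] V} {θ : E}
    (hθ : θ ^ 2 = θ + 1) {v : V} (hv : v ∈ quadKer Z θ) (hv0 : v ≠ 0) :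
    2 ≤ Module.finrank E (quadKer Z θ) := by
  have h2 : (2 : E) = 0 := CharTwo.two_eq_zero
  have hv' := mem_quadKer.1 hv
  have hZv : Z v ∈ quadKer Z θ := by
    rw [mem_quadKer, ← map_smul, ← map_add, ← map_add, hv', map_zero]
  by_contra! hlt
  have h1 : Module.finrank E (quadKer Z θ) ≤ 1 := by omega
  obtain ⟨⟨g, hg⟩, hspan⟩ := finrank_le_one_iff.1 h1
  obtain ⟨c, hc⟩ := hspan ⟨v, hv⟩
  obtain ⟨d, hd⟩ := hspan ⟨Z v, hZv⟩
  have hc' : c • g = v := congrArg Subtype.val hc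
  have hd' : d • g = Z v := congrArg Subtype.val hd
  have hc0 : c ≠ 0 := by rintro rfl; exact hv0 (by rw [← hc', zero_smul])
  have hZ : Z v = (d / c) • v := by
    rw [← hd', ← hc', smul_smul, div_mul_cancel₀ _ hc0]
  set m := d / c
  rw [hZ, map_smul, hZ, smul_smul, smul_smul, ← add_smul] at hv'
  nth_rewrite 2 [← one_smul E v] at hv'
  rw [← add_smul, smul_eq_zero, or_iff_left hv0] at hv'
  refine h5 m ?_
  linear_combination (m * m + (θ + 1) * m + 1) * hv' - m ^ 2 * hθ
    - (m ^ 3 * θ + m ^ 2 + m ^ 2 * θ + m * θ) * h2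

/-- Eliminating `p` leaves a twisted polynomial in `Ψ` of degree four killing `r`, whose reduced
norm is the fifth cyclotomic polynomial in `Z = Ψ²`. That polynomial is
`(Z² + ω Z + 1) (Z² + (ω + 1) Z + 1)`. The kernels of the two factors are disjoint, are exchanged
by `Ψ` and have dimension at least two if nonzero, so that they do not both fit in dimension
three. -/
theorem eq_zero_of_semilinear_relations (τ : E →+* E) (hτ : ∀ x, τ (τ x) = x)
    {ω : E} (hω : ω ^ 2 = ω + 1) (hτω : τ ω = ω + 1)
    (h5 : ∀ m : E, m ^ 4 + m ^ 3 + m ^ 2 + m + 1 ≠ 0)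
    [FiniteDimensional E V] (hV : Module.finrank E V ≤ 3)
    (Ψ : V →ₛₗ[τ] V) (hΨ : ∀ v, Ψ v = 0 → v = 0) {p r : V}
    (h₁ : Ψ p + Ψ (Ψ r) + ω ^ 2 • r = 0)
    (h₂ : Ψ (Ψ p) + ω • Ψ (Ψ r) + ω ^ 2 • p + ω • r = 0) : p = 0 ∧ r = 0 := by
  have h2 : (2 : E) = 0 := CharTwo.two_eq_zero
  have t2 : ∀ v : V, (2 : E) • v = 0 := fun v => by rw [h2, zero_smul]
  have hτω1 : τ (ω + 1) = ω := by rw [map_add, hτω, map_one]; linear_combination h2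
  set Z := semilinearSq τ hτ Ψ with hZ
  have Zap : ∀ v, Ψ (Ψ v) = Z v := fun v => rfl
  have ZΨ : ∀ v, Ψ (Z v) = Z (Ψ v) := fun v => rfl
  have Zinj : ∀ v, Z v = 0 → v = 0 := fun v h => hΨ _ (hΨ _ h)
  rw [hω] at h₁ h₂
  have e₁ : Ψ p = Z r + (ω + 1) • r := by
    rw [Zap] at h₁; linear_combination (norm := module) h₁ - t2 (Z r) - (ω + 1) • t2 r
  have e₂ : Z (Ψ p) + (ω + 1) • Z (Ψ r) + ω • Ψ p + (ω + 1) • Ψ r = 0 := by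
    have := congrArg Ψ h₂
    simpa only [map_add, map_smulₛₗ, hτω, hτω1, map_zero, Zap, ZΨ] using this
  rw [e₁] at e₂
  simp only [map_add, map_smul] at e₂
  have a1 : ∀ v : V, ω • ω • v = (ω + 1) • v := fun v => by rw [smul_smul, ← sq, hω]
  have key1 : Z (Z r) + Z r + r = (ω + 1) • (Z (Ψ r) + Ψ r) := by
    linear_combination (norm := module) e₂ - a1 r - ω • t2 (Z r) - ω • t2 r
      - (ω + 1) • t2 (Z (Ψ r)) - (ω + 1) • t2 (Ψ r)
  have key2 : Z (Z (Ψ r)) + Z (Ψ r) + Ψ r = ω • (Z (Z r) + Z r) := by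
    have := congrArg Ψ key1
    simpa only [map_add, map_smulₛₗ, hτω1, Zap, ZΨ] using this
  -- the part odd in `Ψ` stands on the right of `key1`; applying the even part once more makes it
  -- even, by `key2`
  have key3 : Z (Z (Z (Z r))) + Z (Z (Z r)) + Z (Z r) + Z r + r = 0 := by
    have k1 := congrArg Z key1
    have k2 := congrArg Z k1
    have k3 := congrArg Z key2
    simp only [map_add, map_smul] at k1 k2 k3
    linear_combination (norm := module) k1 + k2 + key1 + (ω + 1) • k3 + (ω + 1) • key2
      + a1 (Z (Z (Z r))) + (2:E) • a1 (Z (Z r)) + a1 (Z r)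
      + ω • t2 (Z (Z (Z r))) + ω • t2 (Z r) + (2 * ω) • t2 (Z (Z r))
  have hω' : (ω + 1) ^ 2 = (ω + 1) + 1 := by linear_combination hω + ω * h2
  have main : r = 0 := by
    by_contra hr
    -- a nonzero vector in one of the two kernels gives one in both
    have swap : ∀ θ θ', τ θ = θ' → ∀ v, v ∈ quadKer Z θ → Ψ v ∈ quadKer Z θ' := by
      intro θ θ' h v hv
      have := congrArg Ψ (mem_quadKer.1 hv)
      rw [mem_quadKer]
      simpa only [map_add, map_smulₛₗ, h, map_zero, ZΨ] using this
    have ex : ∃ v ∈ quadKer Z ω, v ≠ 0 := by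
      by_cases h : Z (Z r) + (ω + 1) • Z r + r = 0
      · exact ⟨Ψ r, swap _ _ hτω1 r (mem_quadKer.2 h), fun h0 => hr (hΨ _ h0)⟩
      · refine ⟨_, mem_quadKer.2 ?_, h⟩
        simp only [map_add, map_smul]
        linear_combination (norm := module) key3 + a1 (Z (Z r)) + ω • t2 (Z (Z (Z r)))
          + ω • t2 (Z (Z r)) + t2 (Z (Z r)) + ω • t2 (Z r)
    obtain ⟨v, hv, hv0⟩ := ex
    have d1 := two_le_finrank_quadKer h5 hω hv hv0
    have d2 := two_le_finrank_quadKer h5 hω' (swap _ _ hτω v hv) (fun h0 => hv0 (hΨ _ h0))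
    have disj : Disjoint (quadKer Z ω) (quadKer Z (ω + 1)) := by
      rw [Submodule.disjoint_def]
      intro x hx hx'
      rw [mem_quadKer] at hx hx'
      apply Zinj
      linear_combination (norm := module) hx' - hx
    have := Submodule.finrank_add_finrank_le_of_disjoint disj
    omega
  refine ⟨hΨ _ ?_, main⟩
  rw [e₁, main, map_zero, smul_zero, add_zero]

end Semilinear

/-! ### Kummer coordinates -/

section Frame

variable (F E K : Type*) [Field F] [Fintype F] [Field E] [Field K]
  [Algebra F E] [Algebra F K] [Algebra E K]

/-- Kummer coordinates for the tower `𝔽_q ⊆ 𝔽_{q²} ⊆ 𝔽_{q⁶}` in characteristic two, where `q` is an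
odd power of two. The elements `1, ε, ε²` form a basis of `K` over `E`, the last two span the
kernel of the trace, and `σ` maps `ε` to a multiple of `ε²`. -/
structure KummerFrame (s : ℕ) where
  ω : E
  κ : E
  δ : E
  ε : K
  two_eq_zero : (2 : E) = 0
  omega_sq : ω ^ 2 = ω + 1
  sigma_omega : sigma F E s ω = ω + 1
  sigma_sigma : ∀ x : E, sigma F E s (sigma F E s x) = x
  no_fifth_root : ∀ m : E, m ^ 4 + m ^ 3 + m ^ 2 + m + 1 ≠ 0
  eps_ne_zero : ε ≠ 0
  eps_cube : ε ^ 3 = algebraMap E K δ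
  sigma_eps : sigma F K s ε = algebraMap E K κ * ε ^ 2
  kappa_rel : sigma F E s κ * κ ^ 2 * δ = ω + 1
  eps_indep : ∀ a b c : E, algebraMap E K a + algebraMap E K b * ε + algebraMap E K c * ε ^ 2 = 0 →
    a = 0 ∧ b = 0 ∧ c = 0
  eps_decomp : ∀ z : K, ∃ a b c : E,
    z = algebraMap E K a + algebraMap E K b * ε + algebraMap E K c * ε ^ 2
  trace_iff : ∀ z : K, Algebra.trace E K z = 0 ↔ ∃ b c : E,
    z = algebraMap E K b * ε + algebraMap E K c * ε ^ 2

variable {F E K}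

theorem sigma_algebraMap (s : ℕ) (x : E) :
    sigma F K s (algebraMap E K x) = algebraMap E K (sigma F E s x) := by
  rw [sigma_apply, sigma_apply, map_pow]

theorem two_pow_mod_three {h : ℕ} (hh : Odd h) : 2 ^ h % 3 = 2 := by
  obtain ⟨k, rfl⟩ := hh
  rw [pow_succ, pow_mul, Nat.mul_mod, Nat.pow_mod]
  simp

theorem pow_eq_of_pow_eq_one {M : Type*} [Monoid M] {x : M} {n a b : ℕ} (hx : x ^ n = 1)
    (h : a % n = b) : x ^ a = x ^ b := by
  rw [← h, ← Nat.mod_add_div a n]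
  simp [pow_add, pow_mul, hx]

variable (F E K) in
omit [Algebra F E] in
/-- An element fixed by `σ²` lies in `𝔽_{q²}`. -/
theorem mem_range_of_sigma_sigma_eq {q s : ℕ} (hF : Nat.card F = q)
    (hE : Nat.card E = q ^ 2) (hK : Nat.card K = q ^ 6) (hs : s = 1 ∨ s = 5) {z : K}
    (hz : sigma F K s (sigma F K s z) = z) : ∃ e : E, algebraMap E K e = z := by
  have hq : Fintype.card F = q := by rw [Fintype.card_eq_nat_card, hF]
  have hq1 : 1 < q := hq ▸ Fintype.one_lt_card
  have : Finite K := Nat.finite_of_card_ne_zero (by rw [hK]; positivity)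
  have : Finite E := Nat.finite_of_card_ne_zero (by rw [hE]; positivity)
  have := Fintype.ofFinite K
  have := Fintype.ofFinite E
  have hKz : z ^ q ^ 6 = z := by
    have := FiniteField.pow_card z
    rwa [Fintype.card_eq_nat_card, hK] at this
  have hz2 : z ^ q ^ 2 = z := by
    rw [sigma_apply, sigma_apply, hq, ← pow_mul, ← pow_add] at hz
    rcases hs with rfl | rfl
    · exact hz
    · have h4 : z ^ q ^ 4 = z := by
        have : z ^ q ^ (5 + 5) = (z ^ q ^ 6) ^ q ^ 4 := by rw [← pow_mul, ← pow_add]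
        rwa [hz, hKz, eq_comm] at this
      have : z ^ q ^ 6 = (z ^ q ^ 4) ^ q ^ 2 := by rw [← pow_mul, ← pow_add]
      rw [h4, hKz] at this
      exact this.symm
  classical
  let P : Polynomial K := Polynomial.X ^ q ^ 2 - Polynomial.X
  have hq2 : 1 < q ^ 2 := Nat.one_lt_pow (by norm_num) hq1
  have hP : P ≠ 0 := FiniteField.X_pow_card_sub_X_ne_zero K hq2
  have hdeg : P.natDegree = q ^ 2 := FiniteField.X_pow_card_sub_X_natDegree_eq K hq2
  have hsub : Finset.univ.image (algebraMap E K) ⊆ P.roots.toFinset := by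
    intro x hx
    obtain ⟨e, -, rfl⟩ := Finset.mem_image.1 hx
    rw [Multiset.mem_toFinset, Polynomial.mem_roots hP]
    have := FiniteField.pow_card e
    rw [Fintype.card_eq_nat_card, hE] at this
    simp [P, ← map_pow, this]
  have hcard : (Finset.univ.image (algebraMap E K)).card = q ^ 2 := by
    rw [Finset.card_image_of_injective _ (algebraMap E K).injective, Finset.card_univ,
      Fintype.card_eq_nat_card, hE]
  have heq := Finset.eq_of_subset_of_card_le hsub (by
    rw [hcard, ← hdeg]
    exact (Multiset.toFinset_card_le _).trans (Polynomial.card_roots' P))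
  have hzr : z ∈ P.roots.toFinset := by
    rw [Multiset.mem_toFinset, Polynomial.mem_roots hP]
    simp [P, hz2]
  rw [← heq] at hzr
  obtain ⟨e, -, he⟩ := Finset.mem_image.1 hzr
  exact ⟨e, he⟩

variable (F E K) in
theorem exists_kummerFrame (q h s : ℕ) (hh : Odd h) (hq : q = 2 ^ h)
    (hF : Nat.card F = q) (hE : Nat.card E = q ^ 2) (hK : Nat.card K = q ^ 6)
    (hs : s = 1 ∨ s = 5) : Nonempty (KummerFrame F E K s) := by
  have hqF : Fintype.card F = q := by rw [Fintype.card_eq_nat_card, hF]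
  have hq1 : 1 < q := hqF ▸ Fintype.one_lt_card
  have : Finite K := Nat.finite_of_card_ne_zero (by rw [hK]; positivity)
  have : Finite E := Nat.finite_of_card_ne_zero (by rw [hE]; positivity)
  have := Fintype.ofFinite K
  have := Fintype.ofFinite E
  have hcE : Fintype.card E = q ^ 2 := by rw [Fintype.card_eq_nat_card, hE]
  have hcK : Fintype.card K = q ^ 6 := by rw [Fintype.card_eq_nat_card, hK]
  have : Fact (Nat.Prime 2) := ⟨Nat.prime_two⟩
  have hchar : CharP E 2 := charP_of_card_eq_prime_pow (f := h * 2) (by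
    rw [hcE, hq, ← pow_mul])
  have h2 : (2 : E) = 0 := CharTwo.two_eq_zero
  have hfin : Module.finrank E K = 3 := by
    have := Module.natCard_eq_pow_finrank (K := E) (V := K)
    rw [hE, hK, ← pow_mul] at this
    have := Nat.pow_right_injective hq1 this
    omega
  have hodd : Odd s := by rcases hs with rfl | rfl <;> decide
  -- the cube root of unity
  obtain ⟨ω, hω3, hω1⟩ : ∃ ω : E, ω ^ 3 = 1 ∧ ω ≠ 1 := by
    have hdvd : 3 ∣ Nat.card Eˣ := by
      rw [Nat.card_units, hE, ← Nat.modEq_iff_dvd' (Nat.one_le_pow _ _ (by omega))]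
      have := two_pow_mod_three hh
      rw [← hq] at this
      simp [Nat.ModEq, Nat.pow_mod, this]
    have : Fact (Nat.Prime 3) := ⟨Nat.prime_three⟩
    obtain ⟨u, hu⟩ := exists_prime_orderOf_dvd_card' 3 hdvd
    refine ⟨u, ?_, ?_⟩
    · rw [← Units.val_pow_eq_pow_val, ← hu, pow_orderOf_eq_one, Units.val_one]
    · intro h1
      rw [Units.val_eq_one] at h1
      simp [h1] at hu
  have hω2 : ω ^ 2 = ω + 1 := by
    have : (ω - 1) * (ω ^ 2 + ω + 1) = 0 := by linear_combination hω3
    rcases mul_eq_zero.1 this with h' | h'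
    · exact absurd (sub_eq_zero.1 h') hω1
    · linear_combination h' - (ω + 1) * h2
  have hω0 : ω ≠ 0 := by rintro rfl; simp at hω3
  have hτω : sigma F E s ω = ω + 1 := by
    rw [sigma_apply, hqF, hq, ← pow_mul, ← hω2]
    exact pow_eq_of_pow_eq_one hω3 (two_pow_mod_three (hh.mul hodd))
  have hττ : ∀ x : E, sigma F E s (sigma F E s x) = x := by
    intro x
    rw [sigma_apply, sigma_apply, ← pow_mul, ← pow_add, hqF, ← two_mul, pow_mul, ← hcE]
    exact FiniteField.pow_card_pow s x
  have h5 : ∀ m : E, m ^ 4 + m ^ 3 + m ^ 2 + m + 1 ≠ 0 := by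
    intro m hm
    have hm5 : m ^ 5 = 1 := by linear_combination (m - 1) * hm
    have hm4 : m ^ 4 = m := by
      have := FiniteField.pow_card m
      rw [hcE] at this
      rw [← pow_eq_of_pow_eq_one (a := q ^ 2) hm5 ?_, this]
      obtain ⟨k, rfl⟩ := hh
      rw [hq, ← pow_mul, mul_comm, pow_mul, pow_succ, pow_mul, Nat.mul_mod, Nat.pow_mod]
      simp
    have hm0 : m ≠ 0 := by rintro rfl; simp at hm5
    have hm1 : m = 1 := by
      have h3 : m ^ 3 = 1 := mul_right_cancel₀ hm0 (by linear_combination hm4)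
      have : m ^ 2 = 1 := by linear_combination hm5 - m ^ 2 * h3
      linear_combination h3 - m * this
    rw [hm1] at hm
    exact one_ne_zero (α := E) (by linear_combination hm - 2 * h2)
  -- the `E`-linear automorphism `σ²`
  have hfix : ∀ z : K, sigma F K s (sigma F K s z) = z → ∃ e : E, algebraMap E K e = z :=
    fun z hz => mem_range_of_sigma_sigma_eq F E K hF hE hK hs hz
  let g : K →ₐ[E] K := { (sigma F K s).toRingHom.comp (sigma F K s).toRingHom with
    commutes' := fun x => by
      change sigma F K s (sigma F K s (algebraMap E K x)) = _
      rw [sigma_algebraMap, sigma_algebraMap, hττ] }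
  have hg : ∀ z, g z = sigma F K s (sigma F K s z) := fun z => rfl
  have hgσ : ∀ z, g (sigma F K s z) = sigma F K s (g z) := fun z => rfl
  have hg3 : ∀ z, g (g (g z)) = z := by
    intro z
    simp only [hg, sigma_apply, ← pow_mul, ← pow_add, hqF]
    rw [show s + s + s + s + s + s = 6 * s by ring, pow_mul, ← hcK]
    exact FiniteField.pow_card_pow s z
  have hgtr : ∀ z, Algebra.trace E K (g z) = Algebra.trace E K z := by
    intro z
    have hbij : Function.Bijective g := Finite.injective_iff_bijective.1 g.toRingHom.injective
    exact Algebra.trace_eq_of_algEquiv (AlgEquiv.ofBijective g hbij) z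
  -- a Lagrange resolvent
  obtain ⟨ε, hε0, hgε⟩ : ∃ ε : K, ε ≠ 0 ∧ g ε = algebraMap E K (ω + 1) * ε := by
    have hgne : ∃ z, g z ≠ z := by
      by_contra! hall
      have hsurj : Function.Surjective (algebraMap E K) := fun z => hfix z (hall z)
      have := Nat.card_le_card_of_surjective _ hsurj
      rw [hE, hK] at this
      exact absurd (Nat.pow_lt_pow_right hq1 (show 2 < 6 by norm_num)) (by omega)
    obtain ⟨z₀, hz₀⟩ := hgne
    let f : Fin 3 → (K →* K) := ![MonoidHom.id K, (g : K →* K), ((g.comp g : K →ₐ[E] K) : K →* K)]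
    have hf : Function.Injective f := by
      have h01 : f 0 ≠ f 1 := fun he => hz₀ (DFunLike.congr_fun he z₀).symm
      have h12 : f 1 ≠ f 2 := fun he => hz₀ (by
        have : g z₀ = g (g z₀) := DFunLike.congr_fun he z₀
        exact (g.toRingHom.injective this).symm)
      have h02 : f 0 ≠ f 2 := fun he => hz₀ (by
        have : z₀ = g (g z₀) := DFunLike.congr_fun he z₀
        conv_lhs => rw [this, hg3])
      intro i j hij
      fin_cases i <;> fin_cases j <;> simp_all [Ne.symm h01, Ne.symm h02, Ne.symm h12]
    have hli := (linearIndependent_monoidHom K K).comp f hf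
    rw [Fintype.linearIndependent_iff] at hli
    have : ∃ z : K, z + algebraMap E K ω * g z + algebraMap E K (ω + 1) * g (g z) ≠ 0 := by
      by_contra! hall
      have := hli ![1, algebraMap E K ω, algebraMap E K (ω + 1)] (by
        funext z
        simpa [Fin.sum_univ_three, f] using hall z) 0
      simp at this
    obtain ⟨z, hz⟩ := this
    refine ⟨_, hz, ?_⟩
    have e1 : algebraMap E K ((ω + 1) * ω) = 1 := by
      rw [← hω2, ← pow_succ, hω3, map_one]
    have e2 : algebraMap E K ((ω + 1) * (ω + 1)) = algebraMap E K ω := by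
      congr 1; linear_combination hω2 + (ω + 1) * h2
    rw [map_mul] at e1 e2
    simp only [map_add g, map_mul g, AlgHom.commutes, hg3]
    linear_combination (-(g z)) * e1 - g (g z) * e2
  have htr1 : ∀ a : E, Algebra.trace E K (algebraMap E K a) = a := by
    intro a
    rw [Algebra.trace_algebraMap, hfin, nsmul_eq_mul]
    push_cast
    linear_combination a * h2
  have htr : ∀ (z : K) (θ : E), θ ≠ 1 → g z = algebraMap E K θ * z → ∀ b : E,
      Algebra.trace E K (algebraMap E K b * z) = 0 := by
    intro z θ hθ hz b
    have h1 := hgtr (algebraMap E K b * z)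
    rw [map_mul, AlgHom.commutes, hz, mul_left_comm, ← Algebra.smul_def, map_smul,
      smul_eq_mul] at h1
    have : (θ - 1) * Algebra.trace E K (algebraMap E K b * z) = 0 := by linear_combination h1
    exact (mul_eq_zero.1 this).resolve_left (sub_ne_zero.2 hθ)
  have hgε2 : g (ε ^ 2) = algebraMap E K ω * ε ^ 2 := by
    rw [map_pow, hgε, mul_pow, ← map_pow]
    congr 2; linear_combination hω2 + (ω + 1) * h2
  have hω11 : ω + 1 ≠ 1 := by simpa using hω0
  have ht1 : ∀ b : E, Algebra.trace E K (algebraMap E K b * ε) = 0 := htr ε _ hω11 hgε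
  have ht2 : ∀ b : E, Algebra.trace E K (algebraMap E K b * ε ^ 2) = 0 := htr _ _ hω1 hgε2
  have htrace : ∀ a b c : E, Algebra.trace E K
      (algebraMap E K a + algebraMap E K b * ε + algebraMap E K c * ε ^ 2) = a := by
    intro a b c
    rw [map_add, map_add, htr1, ht1, ht2, add_zero, add_zero]
  have hind : ∀ a b c : E,
      algebraMap E K a + algebraMap E K b * ε + algebraMap E K c * ε ^ 2 = 0 →
      a = 0 ∧ b = 0 ∧ c = 0 := by
    intro a b c habc
    have ha : a = 0 := by rw [← htrace a b c, habc, map_zero]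
    rw [ha, map_zero] at habc
    have hbc : algebraMap E K b + algebraMap E K c * ε = 0 :=
      mul_right_cancel₀ hε0 (by linear_combination habc)
    have hb : b = 0 := by
      rw [← htrace b c 0, map_zero, zero_mul, add_zero, hbc, map_zero]
    rw [hb, map_zero, zero_add] at hbc
    exact ⟨ha, hb, by simpa [hε0] using hbc⟩
  have hdec : ∀ z : K, ∃ a b c : E,
      z = algebraMap E K a + algebraMap E K b * ε + algebraMap E K c * ε ^ 2 := by
    have hli : LinearIndependent E ![1, ε, ε ^ 2] := by
      rw [Fintype.linearIndependent_iff]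
      intro c hc
      have := hind (c 0) (c 1) (c 2) (by
        simpa [Fin.sum_univ_three, Algebra.smul_def] using hc)
      intro i
      fin_cases i
      exacts [this.1, this.2.1, this.2.2]
    let B := basisOfLinearIndependentOfCardEqFinrank hli (by rw [hfin, Fintype.card_fin])
    intro z
    refine ⟨B.repr z 0, B.repr z 1, B.repr z 2, ?_⟩
    conv_lhs => rw [← B.sum_repr z]
    simp [Fin.sum_univ_three, B, Algebra.smul_def]
  have hωK : algebraMap E K ω ≠ 0 := by simpa using hω0
  obtain ⟨κ, hκ⟩ := hfix (sigma F K s ε / ε ^ 2) (by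
    rw [← hg, map_div₀, hgε2, hgσ, hgε, map_mul, sigma_algebraMap, map_add, hτω, map_one,
      show ω + 1 + 1 = ω by linear_combination h2, mul_div_mul_left _ _ hωK])
  have hσε : sigma F K s ε = algebraMap E K κ * ε ^ 2 := by
    rw [hκ, div_mul_cancel₀ _ (pow_ne_zero 2 hε0)]
  obtain ⟨δ, hδ⟩ := hfix (ε ^ 3) (by
    rw [← hg, map_pow, hgε, mul_pow, ← map_pow,
      show (ω + 1) ^ 3 = 1 by rw [← hω2]; linear_combination (ω ^ 3 + 1) * hω3,
      map_one, one_mul])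
  refine ⟨⟨ω, κ, δ, ε, h2, hω2, hτω, hττ, h5, hε0, hδ.symm, hσε, ?_, hind, hdec, ?_⟩⟩
  · apply (algebraMap E K).injective
    apply mul_right_cancel₀ hε0
    rw [← hgε, hg, hσε, map_mul (sigma F K s), map_pow (sigma F K s), hσε, sigma_algebraMap,
      map_mul, map_mul, hδ, map_pow]
    ring
  · intro z
    constructor
    · intro hz
      obtain ⟨a, b, c, rfl⟩ := hdec z
      rw [htrace] at hz
      exact ⟨b, c, by rw [hz, map_zero, zero_add]⟩
    · rintro ⟨b, c, rfl⟩
      have := htrace 0 b c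
      rwa [map_zero, zero_add] at this

end Frame

namespace KummerFrame

variable {F E K : Type*} [Field F] [Fintype F] [Field E] [Field K]
  [Algebra F E] [Algebra F K] [Algebra E K] {s : ℕ} (kf : KummerFrame F E K s)

/-! ### Relations between vectors of the system -/

/-- The element of the kernel of the trace with coordinates `a`, `b`. -/
noncomputable def comb (a b : E) : K := algebraMap E K a * kf.ε + algebraMap E K b * kf.ε ^ 2

/-- The coefficient of `ε` in `σ (ε²)`. -/
noncomputable def γ : E := kf.κ ^ 2 * kf.δ

theorem two_eq_zero' (kf : KummerFrame F E K s) : (2 : K) = 0 := by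
  have := congrArg (algebraMap E K) kf.two_eq_zero
  rwa [map_ofNat, map_zero] at this

theorem sigma_comb (a b : E) : sigma F K s (kf.comb a b) =
    kf.comb (kf.γ * sigma F E s b) (kf.κ * sigma F E s a) := by
  have h := kf.eps_cube
  simp only [comb, γ, map_add, map_mul, map_pow, sigma_algebraMap, kf.sigma_eps]
  linear_combination (algebraMap E K (sigma F E s b) * algebraMap E K kf.κ ^ 2 * kf.ε) * h

theorem sigma_kappa_mul_gamma : sigma F E s kf.κ * kf.γ = kf.ω + 1 := by
  rw [← kf.kappa_rel, γ, mul_assoc]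

theorem kappa_mul_sigma_gamma : kf.κ * sigma F E s kf.γ = kf.ω := by
  have := congrArg (sigma F E s) kf.sigma_kappa_mul_gamma
  rw [map_mul, kf.sigma_sigma, map_add, kf.sigma_omega, map_one] at this
  linear_combination this + kf.two_eq_zero

theorem kappa_ne_zero : kf.κ ≠ 0 := by
  intro h
  have h1 := kf.kappa_mul_sigma_gamma
  have h2 := kf.omega_sq
  rw [← h1, h] at h2
  simp at h2

theorem sigma_sigma_comb (a b : E) : sigma F K s (sigma F K s (kf.comb a b)) =
    kf.comb ((kf.ω + 1) * a) (kf.ω * b) := by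
  rw [sigma_comb, sigma_comb, map_mul, map_mul, kf.sigma_sigma, kf.sigma_sigma, ← mul_assoc,
    ← mul_assoc, kf.kappa_mul_sigma_gamma, mul_comm kf.γ, kf.sigma_kappa_mul_gamma]

/-- The vector of `U_s` with `x = ε u + ε² u'` and `y = ε v + ε² v'`, in coordinates. -/
noncomputable def param (u u' v v' : E) : Fin 4 → K :=
  ![kf.comb u u', kf.comb v v',
    kf.comb ((kf.ω + 1) * u + kf.γ * sigma F E s v') (kf.ω * u' + kf.κ * sigma F E s v),
    kf.comb (kf.γ * (sigma F E s u' + (kf.ω + 1) * sigma F E s v'))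
      (kf.κ * (sigma F E s u + kf.ω * sigma F E s v))]

theorem mem_systemU_iff [IsScalarTower F E K] {w : Fin 4 → K} :
    w ∈ systemU F E K s ↔ ∃ u u' v v' : E, w = kf.param u u' v v' := by
  have h : ∀ u u' v v' : E, kf.param u u' v v' = ![kf.comb u u', kf.comb v v',
      (sigma F K s)^[2] (kf.comb u u') + sigma F K s (kf.comb v v'),
      sigma F K s (kf.comb u u') + (sigma F K s)^[3] (kf.comb v v')] := by
    intro u u' v v'
    have e2 : (sigma F K s)^[2] (kf.comb u u') + sigma F K s (kf.comb v v') =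
        kf.comb ((kf.ω + 1) * u + kf.γ * sigma F E s v')
          (kf.ω * u' + kf.κ * sigma F E s v) := by
      change sigma F K s (sigma F K s (kf.comb u u')) + _ = _
      rw [kf.sigma_sigma_comb, kf.sigma_comb]
      simp only [comb, map_add (algebraMap E K)]
      ring
    have e3 : sigma F K s (kf.comb u u') + (sigma F K s)^[3] (kf.comb v v') =
        kf.comb (kf.γ * (sigma F E s u' + (kf.ω + 1) * sigma F E s v'))
          (kf.κ * (sigma F E s u + kf.ω * sigma F E s v)) := by
      change _ + sigma F K s (sigma F K s (sigma F K s (kf.comb v v'))) = _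
      rw [kf.sigma_comb v v', kf.sigma_sigma_comb, kf.sigma_comb]
      simp only [comb, map_add (algebraMap E K), map_mul (algebraMap E K)]
      ring
    rw [e2, e3, param]
  constructor
  · rintro ⟨x, y, hx, hy, rfl⟩
    obtain ⟨u, u', rfl⟩ := (kf.trace_iff x).1 hx
    obtain ⟨v, v', rfl⟩ := (kf.trace_iff y).1 hy
    exact ⟨u, u', v, v', (h u u' v v').symm⟩
  · rintro ⟨u, u', v, v', rfl⟩
    exact ⟨_, _, (kf.trace_iff _).2 ⟨u, u', rfl⟩, (kf.trace_iff _).2 ⟨v, v', rfl⟩, h u u' v v'⟩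

theorem comb_eq_zero {a b : E} (h : kf.comb a b = 0) : a = 0 ∧ b = 0 := by
  have := kf.eps_indep 0 a b (by rw [map_zero, zero_add]; exact h)
  exact this.2

theorem comb_add_omega_smul {a b c d : E}
    (h : kf.comb a b + algebraMap E K kf.ω * kf.comb c d = 0) :
    a + kf.ω * c = 0 ∧ b + kf.ω * d = 0 :=
  kf.comb_eq_zero (by simp only [comb, map_add, map_mul] at h ⊢; linear_combination h)

theorem finrank_eq_three (kf : KummerFrame F E K s) : Module.finrank E K = 3 := by
  have hli : LinearIndependent E ![1, kf.ε, kf.ε ^ 2] := by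
    rw [Fintype.linearIndependent_iff]
    intro c hc
    have := kf.eps_indep (c 0) (c 1) (c 2) (by
      simpa [Fin.sum_univ_three, Algebra.smul_def] using hc)
    intro i
    fin_cases i
    exacts [this.1, this.2.1, this.2.2]
  have hsp : ⊤ ≤ Submodule.span E (Set.range ![1, kf.ε, kf.ε ^ 2]) := by
    rintro z -
    obtain ⟨a, b, c, rfl⟩ := kf.eps_decomp z
    have hmem : ∀ i, (![1, kf.ε, kf.ε ^ 2] : Fin 3 → K) i ∈
      Submodule.span E (Set.range ![1, kf.ε, kf.ε ^ 2]) := fun i => Submodule.subset_span ⟨i, rfl⟩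
    have h0 := Submodule.smul_mem _ a (hmem 0)
    have h1 := Submodule.smul_mem _ b (hmem 1)
    have h2 := Submodule.smul_mem _ c (hmem 2)
    have := Submodule.add_mem _ (Submodule.add_mem _ h0 h1) h2
    simpa [Algebra.smul_def] using this
  simpa using Module.finrank_eq_card_basis (Module.Basis.mk hli hsp)

/-- Three vectors of `U_s` satisfying a relation with coefficients that are independent over
`𝔽_{q²}` vanish. In coordinates the relation expresses everything in terms of
`p = ∑ t_j ū'_j` and `r = ∑ t_j v̄'_j`, to which `eq_zero_of_semilinear_relations` applies. -/
theorem eq_zero_of_linearIndependent [IsScalarTower F E K] (kf : KummerFrame F E K s)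
    {t : Fin 3 → K} (ht : LinearIndependent E t) {w : Fin 3 → Fin 4 → K}
    (hw : ∀ j, w j ∈ systemU F E K s)
    (h : ∑ j, t j • w j = 0) : w = 0 := by
  have hfin := kf.finrank_eq_three
  have : FiniteDimensional E K := Module.finite_of_finrank_pos (by omega)
  have : CharP E 2 := CharTwo.of_one_ne_zero_of_two_eq_zero one_ne_zero kf.two_eq_zero
  have h2 := kf.two_eq_zero'
  have hε := kf.eps_ne_zero
  choose u u' v v' hp using fun j => kf.mem_systemU_iff.1 (hw j)
  let τ : E →+* E := (sigma F E s : E →+* E)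
  have hτ : ∀ x, τ x = sigma F E s x := fun x => rfl
  let B := basisOfLinearIndependentOfCardEqFinrank ht (by rw [hfin, Fintype.card_fin])
  have hB : ∀ j, B j = t j := fun j => by simp [B]
  -- the semilinear involution of `K` fixing each `t j`
  let Θ : K →ₛₗ[τ] K :=
    { toFun := fun z => ∑ j, τ (B.repr z j) • t j
      map_add' := fun x y => by simp [add_smul, Finset.sum_add_distrib]
      map_smul' := fun c x => by simp [Finset.smul_sum, mul_smul] }
  -- in coordinates with respect to `t`, this involution is entrywise conjugation
  let br : (Fin 3 → E) → K := fun e => ∑ j, e j • t j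
  have hΘap : ∀ z, Θ z = br (fun j => τ (B.repr z j)) := fun z => rfl
  have hΘ : ∀ e, Θ (br e) = br (fun j => sigma F E s (e j)) := by
    intro e
    have : br e = ∑ j, e j • B j := by simp only [br, hB]
    rw [hΘap, this]
    congr 1
    funext j
    rw [B.repr_sum_self]
    rfl
  have hbr : ∀ e, br e = 0 → e = 0 := by
    intro e he
    funext j
    exact Fintype.linearIndependent_iff.1 ht e he j
  have hΘinj : ∀ z, Θ z = 0 → z = 0 := by
    intro z hz
    have h0 := hbr _ ((hΘap z).symm.trans hz)
    apply B.repr.map_eq_zero_iff.1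
    ext j
    exact (map_eq_zero τ).1 (congrFun h0 j)
  let Ψ : K →ₛₗ[τ] K :=
    { toFun := fun z => algebraMap E K (sigma F E s kf.κ) * kf.ε * Θ z
      map_add' := fun x y => by rw [map_add, mul_add]
      map_smul' := fun c x => by rw [map_smulₛₗ, mul_smul_comm] }
  have hΨap : ∀ z, Ψ z = algebraMap E K (sigma F E s kf.κ) * kf.ε * Θ z := fun z => rfl
  have hκ : algebraMap E K (sigma F E s kf.κ) ≠ 0 := by
    simpa using kf.kappa_ne_zero
  -- the four coordinates of the relation
  have hcoord : ∀ a b : Fin 3 → E, ∑ j, t j * kf.comb (a j) (b j) = 0 →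
      br a + kf.ε * br b = 0 := by
    intro a b hab
    apply mul_right_cancel₀ hε
    simp only [br, comb, Fin.sum_univ_three, Algebra.smul_def] at hab ⊢
    linear_combination hab
  have hc : ∀ i, ∑ j, t j * w j i = 0 := by
    intro i
    have := congrFun h i
    simpa using this
  have k0 := hcoord u u' (by have := hc 0; simp only [hp] at this; exact this)
  have k1 := hcoord v v' (by have := hc 1; simp only [hp] at this; exact this)
  have k2 := hcoord _ _ (by have := hc 2; simp only [hp] at this; exact this)
  have k3 := hcoord _ _ (by have := hc 3; simp only [hp] at this; exact this)
  let cj : (Fin 3 → E) → (Fin 3 → E) := fun e j => sigma F E s (e j)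
  have hΘ' : ∀ e, Θ (br e) = br (cj e) := hΘ
  have hcc : ∀ e, cj (cj e) = e := fun e => funext fun j => kf.sigma_sigma (e j)
  have hu : br u = kf.ε * br u' := by linear_combination k0 - kf.ε * br u' * h2
  have hv : br v = kf.ε * br v' := by linear_combination k1 - kf.ε * br v' * h2
  have k2' : algebraMap E K (kf.ω + 1) * br u + algebraMap E K kf.γ * br (cj v') +
      kf.ε * (algebraMap E K kf.ω * br u' + algebraMap E K kf.κ * br (cj v)) = 0 := by
    simp only [br, cj, Fin.sum_univ_three, Algebra.smul_def, map_add, map_mul] at k2 ⊢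
    linear_combination k2
  have k3' : algebraMap E K kf.γ * (br (cj u') + algebraMap E K (kf.ω + 1) * br (cj v')) +
      kf.ε * (algebraMap E K kf.κ * (br (cj u) + algebraMap E K kf.ω * br (cj v))) = 0 := by
    simp only [br, cj, Fin.sum_univ_three, Algebra.smul_def, map_add, map_mul] at k3 ⊢
    linear_combination k3
  have hΨc : ∀ e, Ψ (br e) = algebraMap E K (sigma F E s kf.κ) * kf.ε * br (cj e) := fun e => by
    rw [hΨap, hΘ']
  have hΨΨ : ∀ e e', br e = kf.ε * br e' → Ψ (Ψ (br (cj e'))) =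
      algebraMap E K (sigma F E s kf.κ) * algebraMap E K kf.κ * kf.ε * br (cj e) := by
    intro e e' hee
    have : Ψ (br (cj e')) = sigma F E s kf.κ • br e := by
      rw [hΨc, hcc, hee, Algebra.smul_def]; ring
    rw [this, map_smulₛₗ, hΨc, hτ, kf.sigma_sigma, Algebra.smul_def]
    ring
  have hκγ := congrArg (algebraMap E K) kf.sigma_kappa_mul_gamma
  have hω := congrArg (algebraMap E K) kf.omega_sq
  simp only [map_add, map_mul, map_pow, map_one] at hκγ hω k2' k3'
  have hres := eq_zero_of_semilinear_relations τ kf.sigma_sigma kf.omega_sq kf.sigma_omega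
    kf.no_fifth_root (by rw [hfin]) Ψ
    (fun z hz => hΘinj z (by simpa [hΨap, hκ, hε, kf.kappa_ne_zero] using hz))
    (p := br (cj u')) (r := br (cj v'))
    (by
      rw [hΨΨ _ _ hv, hΨc, hcc, Algebra.smul_def, map_pow, hω]
      linear_combination (algebraMap E K (sigma F E s kf.κ)) * k2' - (br (cj v')) * hκγ
        - (algebraMap E K (sigma F E s kf.κ)) * (algebraMap E K kf.ω + 1) * hu
        - (algebraMap E K (sigma F E s kf.κ)) * kf.ε * algebraMap E K kf.ω * br u' * h2)
    (by
      rw [hΨΨ _ _ hv, hΨΨ _ _ hu, Algebra.smul_def, Algebra.smul_def, Algebra.smul_def, map_pow, hω]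
      linear_combination (algebraMap E K (sigma F E s kf.κ)) * k3'
        - (br (cj u') + (algebraMap E K kf.ω + 1) * br (cj v')) * hκγ
        - (br (cj v')) * hω - (algebraMap E K kf.ω + 1) * br (cj v') * h2)
  have z1 : ∀ e, br (cj e) = 0 → e = 0 := by
    intro e he
    rw [← hcc e, hbr _ he]
    funext j
    exact map_zero _
  have hu' := z1 _ hres.1
  have hv' := z1 _ hres.2
  have hb0 : br 0 = 0 := by simp [br]
  have hu0 := hbr u (by rw [hu, hu', hb0, mul_zero])
  have hv0 := hbr v (by rw [hv, hv', hb0, mul_zero])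
  funext j
  rw [hp, hu0, hv0, hu', hv']
  funext i
  fin_cases i <;> simp [param, comb]

/-- If multiplication by an element outside `𝔽_{q²}` keeps all coordinates of a vector of `U_s` in
the kernel of the trace, that vector is zero: otherwise the norm of a suitable ratio would give a
primitive fifth root of unity. -/
theorem eq_zero_of_mul_mem_comb {u u' v v' : E} {η : K}
    (hη : ∀ e : E, algebraMap E K e ≠ η)
    (h : ∀ i, ∃ a b : E, η * kf.param u u' v v' i = kf.comb a b) :
    kf.param u u' v v' = 0 := by
  have h2 := kf.two_eq_zero
  have hκ := kf.kappa_ne_zero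
  have hω := kf.omega_sq
  have hδ : kf.δ ≠ 0 := by
    intro h0
    have := kf.eps_cube
    rw [h0, map_zero] at this
    exact kf.eps_ne_zero (by simpa using this)
  obtain ⟨η₀, η₁, η₂, hη'⟩ := kf.eps_decomp η
  -- compare the coefficients of `1`
  have hcoef : ∀ a b c d : E, η * kf.comb a b = kf.comb c d → η₂ * a + η₁ * b = 0 := by
    intro a b c d hab
    have := kf.eps_indep ((η₂ * a + η₁ * b) * kf.δ) (η₀ * a + η₂ * b * kf.δ - c)
      (η₀ * b + η₁ * a - d) (by
        simp only [comb, map_add, map_mul, map_sub] at hab ⊢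
        rw [hη'] at hab
        linear_combination hab - (algebraMap E K η₂ * algebraMap E K a +
          algebraMap E K η₁ * algebraMap E K b + algebraMap E K η₂ * algebraMap E K b * kf.ε) *
            kf.eps_cube)
    exact (mul_eq_zero.1 this.1).resolve_right hδ
  have hi : ∀ i, ∀ a b, kf.param u u' v v' i = kf.comb a b → η₂ * a + η₁ * b = 0 := by
    intro i a b hab
    obtain ⟨c, d, hcd⟩ := h i
    exact hcoef a b c d (hab ▸ hcd)
  have k0 := hi 0 _ _ rfl
  have k1 := hi 1 _ _ rfl
  have k2 := hi 2 _ _ rfl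
  have k3 := hi 3 _ _ rfl
  have hzero : u = 0 → u' = 0 → v = 0 → v' = 0 → kf.param u u' v v' = 0 := by
    rintro rfl rfl rfl rfl
    funext i
    fin_cases i <;> simp [param, comb]
  by_cases hη2 : η₂ = 0
  · have hη1 : η₁ ≠ 0 := by
      rintro rfl
      exact hη η₀ (by rw [hη', hη2]; simp)
    simp only [hη2, zero_mul, zero_add, mul_eq_zero, hη1, false_or] at k0 k1 k2 k3
    have hv : v = 0 := by simpa [k0, hκ] using k2
    have hu : u = 0 := by simpa [hv, hκ] using k3
    exact hzero hu k0 hv k1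
  -- all four coordinates now have the same ratio `l`
  set l := η₁ / η₂ with hl
  have hdiv : ∀ a b : E, η₂ * a + η₁ * b = 0 → a = l * b := by
    intro a b hab
    apply mul_left_cancel₀ hη2
    rw [hl, ← mul_assoc, mul_div_cancel₀ _ hη2]
    linear_combination hab - η₁ * b * h2
  replace k0 := hdiv _ _ k0
  replace k1 := hdiv _ _ k1
  replace k2 := hdiv _ _ k2
  replace k3 := hdiv _ _ k3
  clear_value l
  have hκγ := kf.sigma_kappa_mul_gamma
  rw [k0, k1, map_mul] at k2
  rw [k0, k1, map_mul, map_mul] at k3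
  set lb := sigma F E s l
  set ub := sigma F E s u'
  set vb := sigma F E s v'
  set κb := sigma F E s kf.κ
  have hlb : sigma F E s lb = l := kf.sigma_sigma l
  have hub : sigma F E s ub = u' := kf.sigma_sigma u'
  have hvb : sigma F E s vb = v' := kf.sigma_sigma v'
  have hκb : sigma F E s κb = kf.κ := kf.sigma_sigma kf.κ
  set m := l * lb * kf.κ * κb with hm
  have hmb : sigma F E s m = m := by
    rw [hm, map_mul, map_mul, map_mul, hlb, hκb]; ring
  have c2 : l * κb * u' = (m + kf.ω + 1) * vb := by
    rw [hm]; linear_combination κb * k2 - vb * hκγ - vb * (kf.ω + 1) * h2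
  have c3 : (m + kf.ω + 1) * ub = kf.ω * (1 + m) * vb := by
    rw [hm]
    linear_combination κb * k3 - (ub + (kf.ω + 1) * vb) * hκγ - vb * hω
      + (ub * (kf.ω + 1) + vb * (kf.ω + 1) * (kf.ω + 1)) * h2
      + (l * lb * kf.κ * κb * ub - kf.ω * ub - 4 * kf.ω * vb - kf.ω ^ 2 * vb - ub - 2 * vb) * h2
  have c3' := congrArg (sigma F E s) c3
  simp only [map_mul, map_add, map_one, hmb, kf.sigma_omega, hub, hvb] at c3'
  have hmω : m + kf.ω ≠ 0 := by
    intro h0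
    have := congrArg (sigma F E s) h0
    rw [map_add, hmb, kf.sigma_omega, map_zero] at this
    exact one_ne_zero (α := E) (by linear_combination this - h0)
  have hu' : v' = 0 → u' = 0 := by
    intro hv
    rw [hv, mul_zero] at c3'
    refine (mul_eq_zero.1 c3').resolve_left fun h0 => hmω ?_
    linear_combination h0 - h2
  by_cases hv : v' = 0
  · exact hzero (by rw [k0, hu' hv, mul_zero]) (hu' hv) (by rw [k1, hv, mul_zero]) hv
  exfalso
  have hvb0 : vb ≠ 0 := by
    intro h0
    rw [h0, map_zero] at hvb
    exact hv hvb.symm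
  -- in the product of this equation and its conjugate, the nonzero factor `v' * vb` cancels
  have c4 : l * κb * (kf.ω + 1) * (1 + m) * v' = (m ^ 2 + m + 1) * vb := by
    linear_combination (m + kf.ω) * c2 - l * κb * c3' + vb * hω
      + (l * κb * u' + (m + 1) * kf.ω * vb) * h2
  have c5 := congrArg (sigma F E s) c4
  simp only [map_mul, map_add, map_pow, map_one, hmb, kf.sigma_omega, hvb, hκb] at c5
  refine kf.no_fifth_root m (mul_right_cancel₀ (mul_ne_zero hv hvb0) ?_)
  rw [zero_mul]
  have c6 : m * (kf.ω + 1) * (kf.ω + 1 + 1) * (1 + m) ^ 2 * (v' * vb) =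
      (m ^ 2 + m + 1) ^ 2 * (v' * vb) := by
    have c45 := congrArg₂ (fun x y => x * y) c4 c5
    beta_reduce at c45
    linear_combination c45 + (kf.ω + 1) * (kf.ω + 1 + 1) * (1 + m) ^ 2 * (v' * vb) * hm
  linear_combination (-1 : E) * c6 + m * (1 + m) ^ 2 * (v' * vb) * hω
    + (kf.ω * 2 + 1) * m * (1 + m) ^ 2 * (v' * vb) * h2

theorem param_mem_comb (u u' v v' : E) (i : Fin 4) :
    ∃ a b : E, kf.param u u' v v' i = kf.comb a b := by
  fin_cases i
  exacts [⟨_, _, rfl⟩, ⟨_, _, rfl⟩, ⟨_, _, rfl⟩, ⟨_, _, rfl⟩]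

theorem eq_zero_of_add_omega_mul {a b : E} (h : a + kf.ω * b = 0)
    (h' : sigma F E s a + kf.ω * sigma F E s b = 0) : a = 0 ∧ b = 0 := by
  have h1 := congrArg (sigma F E s) h
  rw [map_add, map_mul, kf.sigma_omega, map_zero] at h1
  have hb : b = 0 := (map_eq_zero (sigma F E s)).1 (by linear_combination h1 - h')
  exact ⟨by simpa [hb] using h, hb⟩

theorem gamma_ne_zero : kf.γ ≠ 0 := by
  intro h
  have h1 := kf.kappa_mul_sigma_gamma
  have h2 := kf.omega_sq
  rw [← h1, h] at h2
  simp at h2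

theorem param_zero : kf.param 0 0 0 0 = 0 := by
  funext i
  fin_cases i <;> simp [param, comb]

/-- The multiples of `U_s` by `1` and by `ω` meet trivially. -/
theorem eq_zero_of_add_omega_smul [IsScalarTower F E K] {w₀ w₁ : Fin 4 → K}
    (h₀ : w₀ ∈ systemU F E K s) (h₁ : w₁ ∈ systemU F E K s)
    (h : w₀ + algebraMap E K kf.ω • w₁ = 0) : w₀ = 0 ∧ w₁ = 0 := by
  obtain ⟨u₀, u₀', v₀, v₀', rfl⟩ := kf.mem_systemU_iff.1 h₀
  obtain ⟨u₁, u₁', v₁, v₁', rfl⟩ := kf.mem_systemU_iff.1 h₁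
  have k0 := kf.comb_add_omega_smul (congrFun h 0)
  have k1 := kf.comb_add_omega_smul (congrFun h 1)
  have k2 := kf.comb_add_omega_smul (congrFun h 2)
  have k3 := kf.comb_add_omega_smul (congrFun h 3)
  have hγ := kf.gamma_ne_zero
  have hκ := kf.kappa_ne_zero
  have hv' := kf.eq_zero_of_add_omega_mul k1.2 (mul_left_cancel₀ hγ
    (by linear_combination k2.1 - (kf.ω + 1) * k0.1))
  have hv := kf.eq_zero_of_add_omega_mul k1.1 (mul_left_cancel₀ hκ
    (by linear_combination k2.2 - kf.ω * k0.2))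
  obtain ⟨rfl, rfl⟩ := hv'
  obtain ⟨rfl, rfl⟩ := hv
  simp only [map_zero, mul_zero, add_zero] at k3
  have hu' := kf.eq_zero_of_add_omega_mul k0.2 (mul_left_cancel₀ hγ
    (by linear_combination k3.1))
  have hu := kf.eq_zero_of_add_omega_mul k0.1 (mul_left_cancel₀ hκ
    (by linear_combination k3.2))
  obtain ⟨rfl, rfl⟩ := hu'
  obtain ⟨rfl, rfl⟩ := hu
  exact ⟨kf.param_zero, kf.param_zero⟩

theorem linearIndependent_one_omega : LinearIndependent F ![1, kf.ω] := by
  have hσ : ∀ x : F, sigma F E s (algebraMap F E x) = algebraMap F E x := AlgHom.commutes _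
  rw [LinearIndependent.pair_iff]
  intro a b hab
  rw [Algebra.smul_def, Algebra.smul_def, mul_one] at hab
  have h1 := congrArg (sigma F E s) hab
  rw [map_add, map_mul, hσ, hσ, kf.sigma_omega, map_zero] at h1
  have hb : b = 0 := (map_eq_zero (algebraMap F E)).1 (by linear_combination h1 - hab)
  refine ⟨(map_eq_zero (algebraMap F E)).1 ?_, hb⟩
  simpa [hb] using hab

theorem exists_add_mul_omega (hE : Module.finrank F E = 2) (e : E) :
    ∃ f g : F, e = algebraMap F E f + algebraMap F E g * kf.ω := by
  let B := basisOfLinearIndependentOfCardEqFinrank kf.linearIndependent_one_omega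
    (by rw [hE, Fintype.card_fin])
  refine ⟨B.repr e 0, B.repr e 1, ?_⟩
  conv_lhs => rw [← B.sum_repr e]
  simp [B, Algebra.smul_def]

/-- A three-dimensional `𝔽_q`-subspace of `K` either has a basis that is independent over `𝔽_{q²}`,
or contains the `𝔽_{q²}`-line of some `t`. Either way it has a generating triple that satisfies no
nontrivial relation with coefficients in `U_s`. -/
theorem exists_generators [IsScalarTower F E K] (kf : KummerFrame F E K s)
    (hE : Module.finrank F E = 2) (S : Submodule F K) (hS : Module.finrank F S = 3) :
    ∃ t : Fin 3 → K, S ≤ Submodule.span F (Set.range t) ∧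
      ∀ w : Fin 3 → Fin 4 → K, (∀ j, w j ∈ systemU F E K s) → ∑ j, t j • w j = 0 → w = 0 := by
  have : FiniteDimensional F S := Module.finite_of_finrank_pos (by omega)
  let b := Module.finBasisOfFinrankEq F S hS
  have hspan : S = Submodule.span F (Set.range fun j => (b j : K)) := by
    have := congrArg (Submodule.map S.subtype) b.span_eq
    rw [Submodule.map_span, ← Set.range_comp, Submodule.map_top, Submodule.range_subtype] at this
    exact this.symm
  have hbF : LinearIndependent F fun j => (b j : K) :=
    b.linearIndependent.map' S.subtype (Submodule.ker_subtype S)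
  by_cases hb : LinearIndependent E fun j => (b j : K)
  · exact ⟨_, hspan.le, fun w hw h => kf.eq_zero_of_linearIndependent hb hw h⟩
  -- a relation over `𝔽_{q²}` yields an `𝔽_{q²}`-line inside `S`
  obtain ⟨e, he, j₀, hj₀⟩ := Fintype.not_linearIndependent_iff.1 hb
  choose f g hfg using kf.exists_add_mul_omega hE
  have h2 := kf.two_eq_zero'
  set t : K := ∑ j, g (e j) • (b j : K) with ht
  set r : K := ∑ j, f (e j) • (b j : K) with hr
  have htS : t ∈ S := Submodule.sum_mem _ fun j _ => Submodule.smul_mem _ _ (b j).2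
  have hrS : r ∈ S := Submodule.sum_mem _ fun j _ => Submodule.smul_mem _ _ (b j).2
  have hrt' : r + algebraMap E K kf.ω * t = 0 := by
    rw [← he, hr, ht, Finset.mul_sum, ← Finset.sum_add_distrib]
    refine Finset.sum_congr rfl fun j _ => ?_
    conv_rhs => rw [hfg (e j)]
    simp only [Algebra.smul_def, map_add, map_mul, ← IsScalarTower.algebraMap_apply]
    ring
  have hrt : algebraMap E K kf.ω * t = r := by linear_combination hrt' - r * h2
  have ht0 : t ≠ 0 := by
    intro h0
    rw [h0, mul_zero] at hrt
    have hg := Fintype.linearIndependent_iff.1 hbF _ (ht.symm.trans h0) j₀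
    have hf := Fintype.linearIndependent_iff.1 hbF _ (hr.symm.trans hrt.symm) j₀
    exact hj₀ (by rw [hfg (e j₀), hg, hf, map_zero, zero_mul, add_zero])
  have hmem : ∀ c : E, algebraMap E K c * t ∈ Submodule.span F {t, r} := by
    intro c
    refine Submodule.mem_span_pair.2 ⟨f c, g c, ?_⟩
    conv_rhs => rw [hfg c]
    rw [← hrt]
    simp only [Algebra.smul_def, map_add, map_mul, ← IsScalarTower.algebraMap_apply]
    ring
  obtain ⟨ξ, hξS, hξ⟩ : ∃ ξ ∈ S, ξ ∉ Submodule.span F {t, r} := by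
    by_contra! hall
    have h1 : Module.finrank F S ≤ Module.finrank F (Submodule.span F {t, r}) := by
      have : FiniteDimensional F (Submodule.span F {t, r}) :=
        FiniteDimensional.span_of_finite F (Set.toFinite _)
      exact Submodule.finrank_mono hall
    have h3 : Module.finrank F (Submodule.span F {t, r}) ≤ 2 := by
      classical
      have := finrank_span_finset_le_card (R := F) ({t, r} : Finset K)
      rw [Set.finrank, Finset.coe_pair] at this
      exact this.trans Finset.card_le_two
    omega
  have hli2 : LinearIndependent F ![t, r] := by
    rw [LinearIndependent.pair_iff]
    intro x y hxy
    rw [← hrt] at hxy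
    refine LinearIndependent.pair_iff.1 kf.linearIndependent_one_omega x y ?_
    apply (algebraMap E K).injective
    apply mul_right_cancel₀ ht0
    simp only [Algebra.smul_def, map_add, map_mul, map_one, map_zero,
      ← IsScalarTower.algebraMap_apply] at hxy ⊢
    linear_combination hxy
  have hli3 : LinearIndependent F ![ξ, t, r] :=
    linearIndependent_finCons.2 ⟨hli2, by simpa [Set.pair_comm r t] using hξ⟩
  refine ⟨![ξ, t, r], ?_, ?_⟩
  · refine (Submodule.eq_of_le_of_finrank_eq (Submodule.span_le.2 ?_) ?_).ge
    · rintro _ ⟨i, rfl⟩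
      fin_cases i
      exacts [hξS, htS, hrS]
    · rw [hS, finrank_span_eq_card hli3, Fintype.card_fin]
  · intro w hw h
    have hrel : ∀ i, ξ * w 0 i + (t * w 1 i + algebraMap E K kf.ω * t * w 2 i) = 0 := by
      intro i
      have := congrFun h i
      rw [← hrt] at this
      simpa [Fin.sum_univ_three, add_assoc] using this
    obtain ⟨u, u', v, v', h0⟩ := kf.mem_systemU_iff.1 (hw 0)
    obtain ⟨u₁, u₁', v₁, v₁', h1⟩ := kf.mem_systemU_iff.1 (hw 1)
    obtain ⟨u₂, u₂', v₂, v₂', h2'⟩ := kf.mem_systemU_iff.1 (hw 2)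
    have hw0 : w 0 = 0 := by
      rw [h0]
      refine kf.eq_zero_of_mul_mem_comb (η := ξ / t) ?_ ?_
      · intro c hc
        exact hξ (by rw [← div_mul_cancel₀ ξ ht0, ← hc]; exact hmem c)
      · intro i
        obtain ⟨a₁, b₁, e1⟩ := kf.param_mem_comb u₁ u₁' v₁ v₁' i
        obtain ⟨a₂, b₂, e2⟩ := kf.param_mem_comb u₂ u₂' v₂ v₂' i
        refine ⟨a₁ + kf.ω * a₂, b₁ + kf.ω * b₂, ?_⟩
        have := hrel i
        rw [h0, h1, h2', e1, e2] at this
        rw [div_mul_eq_mul_div, div_eq_iff ht0]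
        simp only [comb, map_add, map_mul] at this ⊢
        linear_combination this - t * ((algebraMap E K a₁ + algebraMap E K kf.ω *
          algebraMap E K a₂) * kf.ε + (algebraMap E K b₁ + algebraMap E K kf.ω *
          algebraMap E K b₂) * kf.ε ^ 2) * h2
    have h12 := kf.eq_zero_of_add_omega_smul (hw 1) (hw 2) (by
      funext i
      apply mul_left_cancel₀ ht0
      have := hrel i
      rw [hw0] at this
      simp only [Pi.zero_apply, Pi.add_apply, Pi.smul_apply, smul_eq_mul] at this ⊢
      linear_combination this)
    funext j
    fin_cases j
    exacts [hw0, h12.1, h12.2]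

/-- Vectors of `U_s` that are independent over `𝔽_q` satisfy no nontrivial relation whose
coefficients lie in a three-dimensional `𝔽_q`-subspace of `K`. -/
theorem coeff_eq_zero [IsScalarTower F E K] (kf : KummerFrame F E K s) (hE : Module.finrank F E = 2)
    {S : Submodule F K} (hS : Module.finrank F S = 3) {ι : Type*} [Fintype ι]
    {w : ι → Fin 4 → K} (hw : ∀ i, w i ∈ systemU F E K s) (hli : LinearIndependent F w)
    {c : ι → K} (hc : ∀ i, c i ∈ S) (h : ∑ i, c i • w i = 0) (i : ι) : c i = 0 := by
  obtain ⟨t, hSt, ht⟩ := kf.exists_generators hE S hS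
  choose a ha using fun i => (Submodule.mem_span_range_iff_exists_fun F).1 (hSt (hc i))
  have hz := ht (fun j => ∑ i, a i j • w i)
    (fun j => Submodule.sum_mem _ fun i _ => Submodule.smul_mem _ _ (hw i)) (by
      rw [← h]
      simp only [Finset.smul_sum]
      rw [Finset.sum_comm]
      refine Finset.sum_congr rfl fun i _ => ?_
      rw [← ha i, Finset.sum_smul]
      refine Finset.sum_congr rfl fun j _ => ?_
      rw [smul_comm, smul_assoc])
  rw [← ha i]
  refine Finset.sum_eq_zero fun j _ => ?_
  rw [Fintype.linearIndependent_iff.1 hli (fun i => a i j) (congrFun hz j) i, zero_smul]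

end KummerFrame

/-! ### Generalized weights of systems without short relations -/

section RelationFree

variable {F K : Type*} [Field F] [Field K] [Algebra F K] {k : ℕ}

/-- `F`-independent vectors of `U` satisfy no nontrivial `K`-linear relation whose coefficients lie
in an `r`-dimensional `F`-subspace of `K`. Equivalently, every nonzero word of the dual of a code
associated with `U` has rank weight greater than `r`. -/
def RelationFree (U : Submodule F (Fin k → K)) (r : ℕ) : Prop :=
  ∀ S : Submodule F K, Module.finrank F S = r → ∀ (n : ℕ) (w : Fin n → Fin k → K),
    (∀ i, w i ∈ U) → LinearIndependent F w → ∀ c : Fin n → K, (∀ i, c i ∈ S) →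
    ∑ i, c i • w i = 0 → ∀ i, c i = 0

theorem exists_le_finrank_eq {V : Type*} [AddCommGroup V] [Module F V] [FiniteDimensional F V]
    {S : Submodule F V} {r : ℕ} (h : r ≤ Module.finrank F S) :
    ∃ T ≤ S, Module.finrank F T = r := by
  obtain ⟨f, hf⟩ := exists_linearIndependent_of_le_finrank h
  have hf' : LinearIndependent F fun i => (f i : V) :=
    hf.map' S.subtype (Submodule.ker_subtype S)
  refine ⟨Submodule.span F (Set.range fun i => (f i : V)), Submodule.span_le.2 ?_, ?_⟩
  · rintro _ ⟨i, rfl⟩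
    exact (f i).2
  · rw [finrank_span_eq_card hf', Fintype.card_fin]

theorem exists_ge_finrank_eq {V : Type*} [AddCommGroup V] [Module F V] [FiniteDimensional F V]
    {S : Submodule F V} {r : ℕ} (h : Module.finrank F S ≤ r) (hr : r ≤ Module.finrank F V) :
    ∃ T, S ≤ T ∧ Module.finrank F T = r := by
  obtain ⟨C, hC⟩ := Submodule.exists_isCompl S
  have hadd := Submodule.finrank_add_eq_of_isCompl hC
  obtain ⟨D, hD, hDr⟩ := exists_le_finrank_eq (S := C) (r := r - Module.finrank F S) (by omega)
  refine ⟨S ⊔ D, le_sup_left, ?_⟩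
  have := Submodule.finrank_sup_add_finrank_inf_eq S D
  rw [(hC.disjoint.mono_right hD).eq_bot, finrank_bot] at this
  omega

variable {U : Submodule F (Fin k → K)} {r : ℕ}

theorem span_eq_top_of_map_ne_bot
    (h : ∀ f : (Fin k → K) →ₗ[K] K, f ≠ 0 → U.map (f.restrictScalars F) ≠ ⊥) :
    Submodule.span K (U : Set (Fin k → K)) = ⊤ := by
  by_contra hne
  obtain ⟨f, hf, hle⟩ := Submodule.exists_le_ker_of_lt_top _ (lt_top_iff_ne_top.2 hne)
  refine h f hf ((Submodule.eq_bot_iff _).2 ?_)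
  rintro _ ⟨x, hx, rfl⟩
  exact hle (Submodule.subset_span hx)

variable [FiniteDimensional F K]

theorem RelationFree.linearIndependent (hU : RelationFree U r) (hr : r ≤ Module.finrank F K)
    {n : ℕ} (hn : n ≤ r) {w : Fin n → Fin k → K} (hw : ∀ i, w i ∈ U)
    (hli : LinearIndependent F w) : LinearIndependent K w := by
  rw [Fintype.linearIndependent_iff]
  intro c hc
  obtain ⟨S, hcS, hS⟩ := exists_ge_finrank_eq
    (S := Submodule.span F (Set.range c)) (r := r)
    ((finrank_range_le_card c).trans (by rwa [Fintype.card_fin])) hr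
  exact hU S hS n w hw hli c (fun i => hcS (Submodule.subset_span ⟨i, rfl⟩)) hc

theorem RelationFree.weight_le (hU : RelationFree U r) (hr : r ≤ Module.finrank F K)
    {H : Submodule K (Fin k → K)} (hH : Module.finrank K H < r) :
    weight U H ≤ Module.finrank K H := by
  by_contra! hlt
  obtain ⟨f, hf⟩ := exists_linearIndependent_of_le_finrank (R := F) (Nat.succ_le_of_lt hlt)
  have hf' := hf.map' (Submodule.subtype _) (Submodule.ker_subtype _)
  have hK := hU.linearIndependent hr (Nat.succ_le_of_lt hH) (fun i => (f i).2.2) hf'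
  have hle : Submodule.span K (Set.range fun i => (f i : Fin k → K)) ≤ H :=
    Submodule.span_le.2 (by rintro _ ⟨i, rfl⟩; exact (f i).2.1)
  have h1 := Submodule.finrank_mono hle
  have h2 := finrank_span_eq_card hK
  rw [Fintype.card_fin] at h2
  exact absurd (h2.symm.trans_le h1) (by omega)

theorem RelationFree.exists_weight_eq (hU : RelationFree U r) (hr : r ≤ Module.finrank F K)
    {j : ℕ} (hj : j < r) (hjU : j ≤ Module.finrank F U) :
    ∃ H : Submodule K (Fin k → K), Module.finrank K H = j ∧ weight U H = j := by
  obtain ⟨f, hf⟩ := exists_linearIndependent_of_le_finrank (R := F) hjU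
  have hf' := hf.map' U.subtype (Submodule.ker_subtype U)
  have hK := hU.linearIndependent hr hj.le (fun i => (f i).2) hf'
  have hH := finrank_span_eq_card hK
  rw [Fintype.card_fin] at hH
  refine ⟨_, hH, le_antisymm ((hU.weight_le hr (hH.trans_lt hj)).trans hH.le) ?_⟩
  have hle : Submodule.span F (Set.range (U.subtype ∘ f)) ≤
      (Submodule.span K (Set.range (U.subtype ∘ f))).restrictScalars F ⊓ U := by
    refine Submodule.span_le.2 ?_
    rintro _ ⟨i, rfl⟩
    exact ⟨Submodule.subset_span ⟨i, rfl⟩, (f i).2⟩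
  have h1 := Submodule.finrank_mono hle
  rwa [finrank_span_eq_card hf', Fintype.card_fin] at h1

/-- A relation-free system has the largest possible generalized weights of high order. -/
theorem RelationFree.isSystemGenWeight (hU : RelationFree U r) (hr : r ≤ Module.finrank F K)
    {ρ d j : ℕ} (hρ : j + ρ = k) (hj : j < r) (hd : d + j = Module.finrank F U) :
    IsSystemGenWeight U ρ d := by
  refine ⟨j, ⟨?_, ?_⟩, hd⟩
  · obtain ⟨H, hH, hw⟩ := hU.exists_weight_eq hr hj (by omega)
    exact ⟨H, by rw [hH, hρ], hw⟩
  · rintro _ ⟨H, hH, rfl⟩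
    exact (hU.weight_le hr (by omega)).trans (by omega)

/-- If `dim U · r = k [K : F]`, the values of a nonzero linear form on a relation-free `U` span
more than `[K : F] - r` dimensions over `F`. Otherwise, for a nonzero `F`-linear form `φ` on `K`,
the `v` for which `φ (v z) = 0` for all these values `z` would form a space of dimension at least `r`.
By relation-freeness and a dimension count, the vectors of `U` with coefficients in an
`r`-dimensional part of it would combine to all of `K ^ k`, so that the linear form would not be
onto. This is the argument showing that the dual of a maximum rank distance code is again one. -/
theorem RelationFree.lt_finrank_map (hU : RelationFree U r)
    (hdim : Module.finrank F U * r = k * Module.finrank F K)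
    {f : (Fin k → K) →ₗ[K] K} (hf : f ≠ 0) :
    Module.finrank F K < Module.finrank F (U.map (f.restrictScalars F)) + r := by
  by_contra! hle
  -- a nonzero `F`-linear form on `K`
  obtain ⟨φ, hφ0, -⟩ := Submodule.exists_le_ker_of_lt_top (⊥ : Submodule F K) bot_lt_top
  obtain ⟨x₀, hφ⟩ : ∃ x, φ x ≠ 0 := by
    by_contra! hall
    exact hφ0 (LinearMap.ext hall)
  set I := U.map (f.restrictScalars F) with hI
  let b := Module.finBasis F I
  let A : K →ₗ[F] (Fin (Module.finrank F I) → F) :=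
    LinearMap.pi fun j => φ ∘ₗ LinearMap.mulRight F (b j : K)
  have hA : r ≤ Module.finrank F (LinearMap.ker A) := by
    have h1 := LinearMap.finrank_range_add_finrank_ker A
    have h2 := Submodule.finrank_le (LinearMap.range A)
    rw [Module.finrank_fin_fun] at h2
    omega
  obtain ⟨S, hSA, hS⟩ := exists_le_finrank_eq hA
  have hSI : ∀ v ∈ S, ∀ z ∈ I, φ (v * z) = 0 := by
    intro v hv z hz
    have hv' : ∀ j, φ (v * (b j : K)) = 0 := fun j => congrFun (LinearMap.mem_ker.1 (hSA hv)) j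
    have hz' := congrArg Subtype.val (b.sum_repr ⟨z, hz⟩)
    simp only [Submodule.coe_sum, Submodule.coe_smul] at hz'
    rw [← hz', Finset.mul_sum, map_sum]
    refine Finset.sum_eq_zero fun j _ => ?_
    rw [mul_smul_comm, map_smul, hv', smul_zero]
  let u := Module.finBasis F U
  have hu := u.linearIndependent.map' U.subtype (Submodule.ker_subtype U)
  let T : (Fin (Module.finrank F U) → S) →ₗ[F] (Fin k → K) :=
    { toFun := fun v => ∑ i, (v i : K) • (u i : Fin k → K)
      map_add' := fun x y => by simp [add_smul, Finset.sum_add_distrib]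
      map_smul' := fun c x => by simp [Finset.smul_sum] }
  have hT : Function.Injective T := by
    rw [← LinearMap.ker_eq_bot, LinearMap.ker_eq_bot']
    intro v hv
    funext i
    exact Subtype.ext (hU S hS _ _ (fun i => (u i).2) hu (fun i => (v i : K)) (fun i => (v i).2)
      hv i)
  have hTs : Function.Surjective T :=
    (LinearMap.injective_iff_surjective_of_finrank_eq_finrank (by
      rw [Module.finrank_pi_fintype, Module.finrank_pi_fintype]
      simp [hS, hdim])).1 hT
  obtain ⟨z, hz⟩ := LinearMap.surjective hf x₀
  obtain ⟨v, rfl⟩ := hTs z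
  apply hφ
  rw [← hz]
  change φ (f (∑ i, (v i : K) • (u i : Fin k → K))) = 0
  rw [map_sum, map_sum]
  refine Finset.sum_eq_zero fun i _ => ?_
  rw [map_smul, smul_eq_mul]
  exact hSI _ (v i).2 _ ⟨u i, (u i).2, rfl⟩

/-- The weight of the kernel of a linear form and the dimension of its values on `U` add up to the
dimension of `U`. -/
theorem finrank_map_add_weight_ker (f : (Fin k → K) →ₗ[K] K) :
    Module.finrank F (U.map (f.restrictScalars F)) + weight U (LinearMap.ker f) =
      Module.finrank F U := by
  have h := LinearMap.finrank_range_add_finrank_ker ((f.restrictScalars F).domRestrict U)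
  rw [← h, LinearMap.range_domRestrict]
  have : (LinearMap.ker ((f.restrictScalars F).domRestrict U)).map U.subtype =
      (LinearMap.ker f).restrictScalars F ⊓ U := by
    ext x
    simp [and_comm]
  rw [weight, ← this, Submodule.finrank_map_subtype_eq]

end RelationFree

/-! ### Linear forms on a system and codewords -/

section LinearForms

variable {F K : Type*} [Field F] [Field K] [Algebra F K] {n k : ℕ} {U : Submodule F (Fin k → K)}

/-- `d` is the least dimension of the space of values on `U` of a nonzero linear form. -/
def IsMinFormRank (U : Submodule F (Fin k → K)) (d : ℕ) : Prop :=
  IsLeast {w : ℕ | ∃ f : (Fin k → K) →ₗ[K] K, f ≠ 0 ∧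
    Module.finrank F (U.map (f.restrictScalars F)) = w} d

theorem IsMinFormRank.isSystemGenWeight [FiniteDimensional F K] {d : ℕ} (h : IsMinFormRank U d) :
    IsSystemGenWeight U 1 d := by
  obtain ⟨⟨f, hf, hfd⟩, hmin⟩ := h
  have hadd := finrank_map_add_weight_ker (U := U) f
  refine ⟨weight U (LinearMap.ker f), ⟨⟨_, ?_, rfl⟩, ?_⟩, by omega⟩
  · have h1 := LinearMap.finrank_range_add_finrank_ker f
    rw [LinearMap.range_eq_top.2 (LinearMap.surjective hf), finrank_top, Module.finrank_self,
      Module.finrank_fin_fun] at h1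
    omega
  · rintro _ ⟨H, hH, rfl⟩
    have hlt : H < ⊤ := by
      rw [lt_top_iff_ne_top]
      rintro rfl
      rw [finrank_top, Module.finrank_fin_fun] at hH
      omega
    obtain ⟨g, hg, hle⟩ := Submodule.exists_le_ker_of_lt_top H hlt
    have h1 := finrank_map_add_weight_ker (U := U) g
    have h2 := hmin ⟨g, hg, rfl⟩
    have h3 : weight U H ≤ weight U (LinearMap.ker g) :=
      Submodule.finrank_mono (inf_le_inf_right U fun x hx => hle hx)
    omega

theorem IsAssociated.isMinDist {C : Submodule K (Fin n → K)} (h : IsAssociated C U) {d : ℕ}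
    (hd : 0 < d) (hU : IsMinFormRank U d) : IsMinDist F C d := by
  obtain ⟨G, -, hC, -, hGU⟩ := h
  have hrank : ∀ f : (Fin k → K) →ₗ[K] K,
      rankWeight F (fun j => f (G.col j)) =
        Module.finrank F (U.map (f.restrictScalars F)) := by
    intro f
    rw [rankWeight, ← hGU, Submodule.map_span, ← Set.range_comp]
    rfl
  obtain ⟨⟨f, hf, hfd⟩, hmin⟩ := hU
  refine ⟨⟨fun j => f (G.col j), ?_, ?_, (hrank f).trans hfd⟩, ?_⟩
  · have : (fun j => f (G.col j)) = ∑ i, f (Pi.single i 1) • G.row i := by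
      funext j
      rw [f.pi_apply_eq_sum_univ (G.col j), Finset.sum_apply]
      refine Finset.sum_congr rfl fun i _ => ?_
      rw [Pi.smul_apply, smul_eq_mul, smul_eq_mul, mul_comm]
      congr 2
      funext i'
      simp [Pi.single_apply, eq_comm]
    rw [this, ← hC]
    exact Submodule.sum_mem _ fun i _ => Submodule.smul_mem _ _ (Submodule.subset_span ⟨i, rfl⟩)
  · intro h0
    have hz := (hrank f).trans hfd
    rw [h0, rankWeight, (Submodule.span_eq_bot).2 (by rintro _ ⟨j, rfl⟩; rfl), finrank_bot] at hz
    omega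
  · rintro _ ⟨c, hc, hc0, rfl⟩
    rw [← hC] at hc
    obtain ⟨a, rfl⟩ := (Submodule.mem_span_range_iff_exists_fun K).1 hc
    let f : (Fin k → K) →ₗ[K] K := ∑ i, a i • LinearMap.proj i
    have hfc : (∑ i, a i • G.row i) = fun j => f (G.col j) := by
      funext j
      simp [f, Finset.sum_apply]
    rw [hfc] at hc0 ⊢
    rw [hrank]
    exact hmin ⟨f, fun h0 => hc0 (by rw [h0]; rfl), rfl⟩

theorem exists_isAssociated (hn : Module.finrank F U = n)
    (hspan : Submodule.span K (U : Set (Fin k → K)) = ⊤) [FiniteDimensional F U] :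
    ∃ C : Submodule K (Fin n → K), IsAssociated C U := by
  let b := Module.finBasisOfFinrankEq F U hn
  let G : Matrix (Fin k) (Fin n) K := Matrix.of fun i j => (b j : Fin k → K) i
  have hcol : G.col = fun j => (b j : Fin k → K) := rfl
  have hGU : Submodule.span F (Set.range G.col) = U := by
    have := congrArg (Submodule.map U.subtype) b.span_eq
    rwa [Submodule.map_span, ← Set.range_comp, Submodule.map_top, Submodule.range_subtype] at this
  refine ⟨_, G, ?_, rfl, ?_, hGU⟩
  · rw [Fintype.linearIndependent_iff]
    intro a ha
    let f : (Fin k → K) →ₗ[K] K := ∑ i, a i • LinearMap.proj i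
    have hf : ∀ x ∈ U, x ∈ LinearMap.ker f := by
      intro x hx
      rw [← hGU] at hx
      refine (Submodule.span_le (p := (LinearMap.ker f).restrictScalars F)).2 ?_ hx
      rintro _ ⟨j, rfl⟩
      have := congrFun ha j
      simpa [f, Finset.sum_apply] using this
    have hker : LinearMap.ker f = ⊤ := top_le_iff.1 (hspan ▸ Submodule.span_le.2 hf)
    intro i
    have : f (Pi.single i 1) = 0 := by
      rw [← LinearMap.mem_ker, hker]; trivial
    simpa [f, Pi.single_apply] using this
  · rw [hcol]
    exact b.linearIndependent.map' U.subtype (Submodule.ker_subtype U)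

theorem IsSystemGenWeight.unique {ρ d d' : ℕ} (h : IsSystemGenWeight U ρ d)
    (h' : IsSystemGenWeight U ρ d') : d = d' := by
  obtain ⟨w, hw, hd⟩ := h
  obtain ⟨w', hw', hd'⟩ := h'
  have := hw.unique hw'
  omega

end LinearForms

/-! ### The parameters of the system -/

namespace KummerFrame

variable {F E K : Type*} [Field F] [Fintype F] [Field E] [Field K]
  [Algebra F E] [Algebra F K] [Algebra E K] [IsScalarTower F E K] {s : ℕ}

/-- The coordinates on the kernel of the trace, as a linear map. -/
noncomputable def combMap (kf : KummerFrame F E K s) : (E × E) →ₗ[F] K where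
  toFun e := kf.comb e.1 e.2
  map_add' x y := by simp only [comb, Prod.fst_add, Prod.snd_add, map_add]; ring
  map_smul' c x := by
    simp only [comb, Prod.smul_fst, Prod.smul_snd]
    simp only [Algebra.smul_def, map_mul, ← IsScalarTower.algebraMap_apply, RingHom.id_apply]
    ring

theorem combMap_injective (kf : KummerFrame F E K s) : Function.Injective kf.combMap := by
  rw [← LinearMap.ker_eq_bot, LinearMap.ker_eq_bot']
  rintro ⟨a, b⟩ h
  obtain ⟨rfl, rfl⟩ := kf.comb_eq_zero h
  rfl

theorem finrank_range_combMap (kf : KummerFrame F E K s) (hE : Module.finrank F E = 2) :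
    Module.finrank F (LinearMap.range kf.combMap) = 4 := by
  have : FiniteDimensional F E := Module.finite_of_finrank_pos (by omega)
  rw [LinearMap.finrank_range_of_inj kf.combMap_injective, Module.finrank_prod, hE]

theorem finrank_systemU (kf : KummerFrame F E K s) (hE : Module.finrank F E = 2) :
    Module.finrank F (systemU F E K s) = 8 := by
  have : FiniteDimensional F E := Module.finite_of_finrank_pos (by omega)
  -- the first two coordinates of a vector of `U_s` are arbitrary in the kernel of the trace
  let p : systemU F E K s →ₗ[F] K × K :=
    ((LinearMap.proj 0).prod (LinearMap.proj 1)) ∘ₗ (systemU F E K s).subtype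
  have hp : Function.Injective p := by
    rw [← LinearMap.ker_eq_bot, LinearMap.ker_eq_bot']
    rintro ⟨w, hw⟩ h
    obtain ⟨u, u', v, v', rfl⟩ := kf.mem_systemU_iff.1 hw
    obtain ⟨rfl, rfl⟩ := kf.comb_eq_zero (congrArg Prod.fst h)
    obtain ⟨rfl, rfl⟩ := kf.comb_eq_zero (congrArg Prod.snd h)
    exact Subtype.ext kf.param_zero
  have hrange : LinearMap.range p = LinearMap.range (kf.combMap.prodMap kf.combMap) := by
    ext ⟨x, y⟩
    constructor
    · rintro ⟨⟨w, hw⟩, h⟩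
      obtain ⟨u, u', v, v', rfl⟩ := kf.mem_systemU_iff.1 hw
      exact ⟨((u, u'), (v, v')), h⟩
    · rintro ⟨⟨⟨u, u'⟩, ⟨v, v'⟩⟩, h⟩
      exact ⟨⟨_, kf.mem_systemU_iff.2 ⟨u, u', v, v', rfl⟩⟩, h⟩
  rw [← LinearMap.finrank_range_of_inj hp, hrange, LinearMap.finrank_range_of_inj
    (kf.combMap_injective.prodMap kf.combMap_injective)]
  simp [hE]

theorem relationFree_systemU (kf : KummerFrame F E K s) (hE : Module.finrank F E = 2) :
    RelationFree (systemU F E K s) 3 :=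
  fun _ hS _ _ hw hli _ hc h => kf.coeff_eq_zero hE hS hw hli hc h

theorem isMinFormRank_systemU (kf : KummerFrame F E K s) (hE : Module.finrank F E = 2)
    (hK : Module.finrank F K = 6) :
    IsMinFormRank (systemU F E K s) 4 := by
  have : FiniteDimensional F K := Module.finite_of_finrank_pos (by omega)
  have hlow : ∀ f : (Fin 4 → K) →ₗ[K] K, f ≠ 0 →
      4 ≤ Module.finrank F ((systemU F E K s).map (f.restrictScalars F)) := by
    intro f hf
    have := (kf.relationFree_systemU hE).lt_finrank_map
      (by rw [kf.finrank_systemU hE, hK]) hf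
    omega
  -- the first coordinate takes values in the kernel of the trace
  have hne : (LinearMap.proj 0 : (Fin 4 → K) →ₗ[K] K) ≠ 0 := fun h => by
    simpa using LinearMap.congr_fun h 1
  refine ⟨⟨LinearMap.proj 0, hne, le_antisymm ?_ (hlow _ hne)⟩, ?_⟩
  · refine (Submodule.finrank_mono ?_).trans_eq (kf.finrank_range_combMap hE)
    rintro _ ⟨w, hw, rfl⟩
    obtain ⟨u, u', v, v', rfl⟩ := kf.mem_systemU_iff.1 hw
    exact ⟨(u, u'), rfl⟩
  · rintro _ ⟨f, hf, rfl⟩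
    exact hlow f hf

end KummerFrame

end RankMetric

theorem mainTheorem3 {F E K : Type*} [Field F] [Fintype F] [Field E] [Field K]
    [Algebra F E] [Algebra F K] [Algebra E K] [IsScalarTower F E K]
    (q h s : ℕ) (hh : Odd h) (hq : q = 2 ^ h)
    (hF : Nat.card F = q) (hE : Nat.card E = q ^ 2) (hK : Nat.card K = q ^ 6)
    (hs1 : 1 ≤ s) (hs5 : s ≤ 5) (hs : Nat.gcd s 6 = 1) :
    RankMetric.IsSystem (RankMetric.systemU F E K s) 8 4 ∧
    (∃ C : Submodule K (Fin 8 → K), RankMetric.IsAssociated C (RankMetric.systemU F E K s)) ∧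
    ∀ C : Submodule K (Fin 8 → K), RankMetric.IsAssociated C (RankMetric.systemU F E K s) →
      RankMetric.IsCode F C 4 4 ∧ RankMetric.IsMRD F C ∧
      RankMetric.IsGenWeight F C 2 6 ∧
      RankMetric.IsRhoMRD F C 2 ∧ ¬ RankMetric.IsRhoMRD F C 1 ∧
      RankMetric.IsNearMRD F C := by
  have hs' : s = 1 ∨ s = 5 := by interval_cases s <;> simp_all
  have hq1 : 1 < q := by rw [← hF, ← Fintype.card_eq_nat_card]; exact Fintype.one_lt_card
  have : Finite K := Nat.finite_of_card_ne_zero (by rw [hK]; positivity)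
  have : Finite E := Nat.finite_of_card_ne_zero (by rw [hE]; positivity)
  have hE2 : Module.finrank F E = 2 := by
    have := Module.natCard_eq_pow_finrank (K := F) (V := E)
    rw [hE, hF] at this
    exact (Nat.pow_right_injective hq1 this).symm
  have hK6 : Module.finrank F K = 6 := by
    have := Module.natCard_eq_pow_finrank (K := F) (V := K)
    rw [hK, hF] at this
    exact (Nat.pow_right_injective hq1 this).symm
  obtain ⟨kf⟩ := RankMetric.exists_kummerFrame F E K q h s hh hq hF hE hK hs'
  have h8 := kf.finrank_systemU hE2
  have hmin := kf.isMinFormRank_systemU hE2 hK6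
  have hfree := kf.relationFree_systemU hE2
  have hspan : Submodule.span K (RankMetric.systemU F E K s : Set (Fin 4 → K)) = ⊤ := by
    refine RankMetric.span_eq_top_of_map_ne_bot fun f hf h0 => ?_
    have := hmin.2 ⟨f, hf, rfl⟩
    rw [h0, finrank_bot] at this
    omega
  have hgen : ∀ ρ, 2 ≤ ρ → ρ ≤ 4 →
      RankMetric.IsSystemGenWeight (RankMetric.systemU F E K s) ρ (8 - 4 + ρ) := fun ρ h2 h4 =>
    hfree.isSystemGenWeight (j := 4 - ρ) (by omega) (by omega) (by omega) (by omega)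
  refine ⟨⟨h8, hspan, hmin.isSystemGenWeight⟩, RankMetric.exists_isAssociated h8 hspan, ?_⟩
  intro C hC
  have hC4 := hC.finrank_eq
  have hd := hC.isMinDist (by norm_num) hmin
  have hCgen : ∀ ρ, 2 ≤ ρ → ρ ≤ 4 → RankMetric.IsGenWeight F C ρ (8 - 4 + ρ) :=
    fun ρ h2 h4 => (hC.isGenWeight_iff ρ _).2 (hgen ρ h2 h4)
  refine ⟨⟨hC4, hd⟩, ⟨4, hd, by rw [hK6, hC4]; rfl⟩, hCgen 2 le_rfl (by norm_num), ?_, ?_, ?_⟩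
  · rw [RankMetric.IsRhoMRD, hC4]
    exact hCgen 2 le_rfl (by norm_num)
  · rw [RankMetric.IsRhoMRD, hC4, hC.isGenWeight_iff]
    intro h5
    exact absurd (h5.unique hmin.isSystemGenWeight) (by norm_num)
  · rw [RankMetric.IsNearMRD, hC4]
    exact ⟨hd, hCgen⟩
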